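/- Let $R$ be an integrally closed Noetherian domain with finitely many maximal ideals, all of the same height, and let $p$ be a prime number which is nonzero in $R$ and lies in the Jacobson radical of $R$. Let $x,y\in R$ be such that $p,x,y$ are parameters, that is, any $k$ of the three elements $p,x,y$ (at distinct positions) generate an ideal of height exactly $k$. Assume that there is $\sigma\in R$ with $\sigma^{p-1}=p$, and that $N\ge 0$ is an integer such that $p^N$, $x$ and $y$ each annihilate the first Koszul homology module $H_1(p^m,x^m,y^m;R)$ for every integer $m\ge 1$. Let $z\in R$ satisfy $p^Nz\in(x,y)R$. Then: (i) for every rational number $e=a/b>0$ in lowest terms there are a domain $S\supseteq R$, finitely generated as an $R$-module, and a $b$-th root $\rho\in S$ of $p$ such that $p^e z\in(x,y)S$, where $p^e:=\rho^a$; (ii) consequently $z$ lies in the full extended plus closure of the ideal $I=(x,y)R$; that is, writing $R^+$ for the integral closure of $R$ in an algebraic closure of its fraction field, there is a nonzero $c\in R$ such that for every integer $n\ge1$ there is an $n$-th root $c^{1/n}\in R^+$ of $c$ with $c^{1/n}z\in IR^++p^nR^+$. -/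

import Mathlib

universe u

/-- A family of elements of `R` is a set of parameters if every subfamily of `k` members generates
an ideal of height exactly `k`. (The empty subfamily is harmless: the zero ideal of a domain has
height `0`. The unit ideal has height `⊤`, so it is excluded.) -/
def IsParameterSet {R : Type u} [CommRing R] {ι : Type} (v : ι → R) : Prop :=
  ∀ s : Finset ι, (Ideal.span (v '' (s : Set ι))).height = (s.card : ℕ∞)

/-- The differential `K₁ = R³ → K₀ = R` of the Koszul complex of `x 0, x 1, x 2`: it sends the
basis vector `eᵢ` to `x i`. -/
def koszulD1 {R : Type u} [CommRing R] (x : Fin 3 → R) : (Fin 3 → R) →ₗ[R] R :=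
  Fintype.linearCombination R x

/-- The differential `K₂ = R³ → K₁ = R³` of the Koszul complex of `x 0, x 1, x 2`, in the bases
`e₀ ∧ e₁, e₀ ∧ e₂, e₁ ∧ e₂` and `e₀, e₁, e₂`: it sends `eᵢ ∧ eⱼ` to `x i • eⱼ - x j • eᵢ`. -/
def koszulD2 {R : Type u} [CommRing R] (x : Fin 3 → R) : (Fin 3 → R) →ₗ[R] (Fin 3 → R) :=
  Matrix.mulVecLin !![-x 1, -x 2, 0; x 0, 0, -x 2; 0, x 0, x 1]

theorem koszulD1_comp_koszulD2 {R : Type u} [CommRing R] (x : Fin 3 → R) :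
    koszulD1 x ∘ₗ koszulD2 x = 0 := by
  refine LinearMap.ext fun f => ?_
  simp [koszulD1, koszulD2, Fintype.linearCombination_apply, Fin.sum_univ_three,
    dotProduct]
  ring

/-- The first Koszul homology `H₁(x 0, x 1, x 2; R)`: the kernel of `K₁ → K₀` modulo the image of
`K₂ → K₁`. -/
abbrev KoszulH1 {R : Type u} [CommRing R] (x : Fin 3 → R) : Type u :=
  LinearMap.ker (koszulD1 x) ⧸
    (LinearMap.range (koszulD2 x)).submoduleOf (LinearMap.ker (koszulD1 x))

/-- `r` kills the module `M`. -/
def Kills {R : Type u} [CommRing R] (r : R) (M : Type u) [AddCommGroup M] [Module R M] : Prop :=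
  ∀ h : M, r • h = 0

/-- `t` is a value of the rational power `c ^ e`: writing `e = a / b` in lowest terms,
`t` is the `a`-th power of a `b`-th root of `c`. -/
def IsRationalPower {A : Type u} [CommRing A] (c : A) (e : ℚ≥0) (t : A) : Prop :=
  ∃ ρ : A, ρ ^ e.den = c ∧ t = ρ ^ e.num

/-- `R⁺`, the integral closure of the domain `R` in an algebraic closure of its fraction field. -/
abbrev PlusRing (R : Type u) [CommRing R] [IsDomain R] : Type u :=
  integralClosure R (AlgebraicClosure (FractionRing R))

/-- The full extended plus closure of `I` (with respect to the prime `p`): all `z` such that for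
some nonzero `c` in `R` one has `c^(1/n) z ∈ (I, p^n) R⁺` for every positive integer `n`.
The choice of the `n`-th root of `c` in `R⁺` is irrelevant, as two of them differ by a root of
unity. -/
def fullExtendedPlusClosure {R : Type u} [CommRing R] [IsDomain R] (p : ℕ) (I : Ideal R) :
    Set R :=
  {z | ∃ c : R, c ≠ 0 ∧ ∀ n : ℕ, 0 < n → ∃ d : PlusRing R,
    d ^ n = algebraMap R (PlusRing R) c ∧
      d * algebraMap R (PlusRing R) z ∈
        I.map (algebraMap R (PlusRing R)) ⊔ Ideal.span {(p : PlusRing R) ^ n}}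

/-! ### Counting in the `p`-adic tree of natural numbers -/

/-! Write p^N z = ux + vy, ω₀ = u/(y p^N), ω₁ = -v/(x p^N), so ω₀ - ω₁ = z/(xy), and let O₀ =
R[1/y], O₁ = R[1/x]. With ρ^b = p, it suffices to find τ algebraic over the fraction field with each
ρ^a(τ + ω_j) integral over O_j: xy times their difference is ρ^a z, and normality makes yρ^a(τ + ω₀)
and xρ^a(τ + ω₁) integral over R. So one wants a monic polynomial of degree q = p^n whose two
translates have k-th coefficient in p^(-⌊ak/b⌋) O_j.

Inverting the polynomial, one looks for a truncated section ∑ f_i T^(-(q+i)) with f_0 = 1 whose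
translates satisfy the same bounds for k ≤ q. It is built degree by degree; the difference of the
two translated coefficients, modulo O₀ + O₁, obstructs the choice of f_k. By the Koszul hypothesis
p^N, x and y kill the obstructions, which therefore lie in O₀ + O₁ + R·1/(xy) and are measured by
ideals of R. In negative degrees, divided derivatives and shifts act on sections, so the ideal g(E)
in total degree E is contained in g(E + j) whenever p does not divide C(E+j, j). By Lucas, g grows
along the tree of base p expansions, and the ascending chain condition shows that g(E) depends only
on the last w digits of E, outside a set of small density (`exists_card_add_pow_ne_mod_le`).

In a good degree the obstruction is that of a section starting only h = p^w places earlier, and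
subtracting this section removes it. In a bad degree everything is multiplied by p^N. Bad degrees
are so rare that dividing by the accumulated power of p at the end respects the bounds
(`exists_seq_pow_mul_twistedSum_mem`). Part (ii) is the case e = 1/n, with c = p. -/

theorem choose_add_pow_mul_modEq {p : ℕ} (hp : p.Prime) (w : ℕ) :
    ∀ {a : ℕ} (c d : ℕ), a < p ^ w →
      (a + p ^ w * c).choose (p ^ w * d) ≡ c.choose d [MOD p] := by
  have := Fact.mk hp
  induction w with
  | zero =>
    intro a c d ha
    have : a = 0 := by simpa using ha
    subst this
    simp [Nat.ModEq.refl]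
  | succ w ih =>
    intro a c d ha
    have h := Choose.choose_modEq_choose_mod_mul_choose_div_nat
      (n := a + p ^ (w + 1) * c) (k := p ^ (w + 1) * d) (p := p)
    have hp0 := hp.pos
    have e1 : p ^ (w + 1) * d = p * (p ^ w * d) := by ring
    have e2 : a + p ^ (w + 1) * c = a + p * (p ^ w * c) := by ring
    have h1 : p ^ (w + 1) * d % p = 0 := by rw [e1]; exact Nat.mul_mod_right _ _
    have h2 : p ^ (w + 1) * d / p = p ^ w * d := by rw [e1]; exact Nat.mul_div_cancel_left _ hp0
    have h3 : (a + p ^ (w + 1) * c) / p = a / p + p ^ w * c := by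
      rw [e2]; exact Nat.add_mul_div_left _ _ hp0
    rw [h1, h2, h3, Nat.choose_zero_right, one_mul] at h
    refine h.trans (ih c d ?_)
    rw [Nat.div_lt_iff_lt_mul hp0]
    rwa [pow_succ] at ha

theorem not_dvd_choose_add_pow_mul {p : ℕ} (hp : p.Prime) {w a : ℕ} (c d : ℕ) (ha : a < p ^ w)
    (h : ¬ p ∣ c.choose d) : ¬ p ∣ (a + p ^ w * c).choose (p ^ w * d) := fun h' =>
  h (((choose_add_pow_mul_modEq hp w c d ha).dvd_iff dvd_rfl).1 h')

theorem card_filter_mod_mem {p w v : ℕ} (hp : 0 < p) (hvw : v ≤ w) (B : Finset ℕ)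
    (hB : ∀ b ∈ B, b < p ^ v) :
    ((Finset.range (p ^ w)).filter fun E => E % p ^ v ∈ B).card = B.card * p ^ (w - v) := by
  have hv : 0 < p ^ v := pow_pos hp v
  have e : p ^ w = p ^ v * p ^ (w - v) := by rw [← pow_add]; congr 1; omega
  rw [← Finset.card_range (p ^ (w - v)), ← Finset.card_product]
  symm
  refine Finset.card_nbij' (fun x => x.1 + p ^ v * x.2) (fun E => (E % p ^ v, E / p ^ v)) ?_ ?_ ?_ ?_
  · rintro ⟨b, c⟩ h
    simp only [Finset.coe_product, Set.mem_prod, Finset.mem_coe, Finset.mem_range] at h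
    have hb := hB b h.1
    simp only [Finset.coe_filter, Finset.mem_range, Set.mem_ofPred_eq, Nat.add_mul_mod_self_left,
      Nat.mod_eq_of_lt hb]
    refine ⟨?_, h.1⟩
    calc b + p ^ v * c < p ^ v + p ^ v * c := by omega
      _ = p ^ v * (c + 1) := by ring
      _ ≤ p ^ v * p ^ (w - v) := Nat.mul_le_mul_left _ h.2
      _ = p ^ w := e.symm
  · intro E h
    simp only [Finset.coe_filter, Finset.mem_range, Set.mem_ofPred_eq] at h
    simp only [Finset.coe_product, Set.mem_prod, Finset.mem_coe, Finset.mem_range]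
    exact ⟨h.2, Nat.div_lt_of_lt_mul (e ▸ h.1)⟩
  · rintro ⟨b, c⟩ h
    simp only [Finset.coe_product, Set.mem_prod, Finset.mem_coe, Finset.mem_range] at h
    have hb := hB b h.1
    simp [Nat.mod_eq_of_lt hb, Nat.add_mul_div_left _ _ hv, Nat.div_eq_of_lt hb]
  · intro E _
    exact Nat.mod_add_div E (p ^ v)

section Tree

variable {α : Type*} [PartialOrder α] {p : ℕ} {g : ℕ → α}

open Classical in
-- Noetherian induction on the value `s` at the node `a`. The density of descendants where `g` has
-- left `s` increases with the level and is at most 1, so from some level `w₁` on it gains at most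
-- ε/2. Below the nodes that have left by then, `g` is strictly larger than `s` and the induction
-- applies.
theorem exists_card_ne_mod_le_of_node [WellFoundedGT α] (hp : 0 < p)
    (hg : ∀ E w, g (E % p ^ w) ≤ g E) (s : α) :
    ∀ v a, a < p ^ v → g a = s → ∀ ε : ℝ, 0 < ε → ∃ w₀, ∀ w, w₀ ≤ w →
      (((Finset.range (p ^ w)).filter
        fun E => E % p ^ v = a ∧ g E ≠ g (E % p ^ w₀)).card : ℝ) ≤ ε * (p : ℝ) ^ w := by
  induction s using WellFoundedGT.induction with
  | ind s ih =>
  intro v a ha hs ε hε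
  have hpw : ∀ w, (0 : ℝ) < (p : ℝ) ^ w := fun w => pow_pos (by exact_mod_cast hp) w
  set ch : ℕ → Finset ℕ := fun w =>
    (Finset.range (p ^ w)).filter fun E => E % p ^ v = a ∧ g E ≠ s with hch
  have hch_lt : ∀ w, ∀ b ∈ ch w, b < p ^ w := fun w b hb =>
    Finset.mem_range.1 (Finset.mem_filter.1 hb).1
  have hmm : ∀ E {w₁ w₂ : ℕ}, w₁ ≤ w₂ → E % p ^ w₂ % p ^ w₁ = E % p ^ w₁ := fun E w₁ w₂ h =>
    Nat.mod_mod_of_dvd _ (pow_dvd_pow p h)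
  have hmono : ∀ E {w₁ w₂ : ℕ}, w₁ ≤ w₂ → g (E % p ^ w₁) ≤ g (E % p ^ w₂) := fun E w₁ w₂ h => by
    rw [← hmm E h]; exact hg _ _
  have hsub : ∀ {w₁ w}, v ≤ w₁ → w₁ ≤ w →
      ((Finset.range (p ^ w)).filter fun E => E % p ^ w₁ ∈ ch w₁) ⊆ ch w := by
    intro w₁ w hv hw E hE
    simp only [hch, Finset.mem_filter, Finset.mem_range] at hE ⊢
    refine ⟨hE.1, by rw [← hE.2.2.1, hmm E hv], fun h => hE.2.2.2 (le_antisymm ?_ ?_)⟩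
    · rw [← h]; exact hg _ _
    · rw [← hs, ← hE.2.2.1, hmm E hv]; exact hmono E hv
  set c : ℕ → ℝ := fun w => (ch w).card / (p : ℝ) ^ w with hc
  have hc1 : ∀ w, c w ≤ 1 := fun w => by
    rw [hc]
    simp only
    rw [div_le_one (hpw w)]
    have : (ch w).card ≤ p ^ w := by
      simpa using Finset.card_filter_le (Finset.range (p ^ w)) (fun E => E % p ^ v = a ∧ g E ≠ s)
    exact_mod_cast this
  obtain ⟨w₁, hvw₁, hw₁⟩ : ∃ w₁, v ≤ w₁ ∧ ∀ w, v ≤ w → c w ≤ c w₁ + ε / 2 := by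
    have hne : (c '' Set.Ici v).Nonempty := ⟨c v, v, le_refl v, rfl⟩
    have hbdd : BddAbove (c '' Set.Ici v) := ⟨1, by rintro _ ⟨w, _, rfl⟩; exact hc1 w⟩
    obtain ⟨_, ⟨w₁, h1, rfl⟩, h2⟩ := exists_lt_of_lt_csSup hne
      (show sSup (c '' Set.Ici v) - ε / 2 < sSup (c '' Set.Ici v) by linarith)
    refine ⟨w₁, h1, fun w hw => ?_⟩
    have := le_csSup hbdd (Set.mem_image_of_mem c (show w ∈ Set.Ici v from hw))
    linarith
  -- There are at most p^w₁ such nodes, so these shares add up to at most ε/2.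
  have hIH : ∀ b ∈ ch w₁, ∃ w₀, ∀ w, w₀ ≤ w →
      (((Finset.range (p ^ w)).filter
        fun E => E % p ^ w₁ = b ∧ g E ≠ g (E % p ^ w₀)).card : ℝ)
        ≤ ε / (2 * (p : ℝ) ^ w₁) * (p : ℝ) ^ w := by
    intro b hb
    have hb' := (Finset.mem_filter.1 hb).2
    refine ih (g b) ?_ w₁ b (hch_lt _ _ hb) rfl _ (by have := hpw w₁; positivity)
    refine lt_of_le_of_ne ?_ (Ne.symm hb'.2)
    rw [← hs, ← hb'.1]
    exact hg _ _
  choose! W hW using hIH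
  refine ⟨max w₁ ((ch w₁).sup W), fun w hw => ?_⟩
  set w₀ := max w₁ ((ch w₁).sup W) with hw₀
  have hw1 : w₁ ≤ w := (le_max_left _ _).trans hw
  have hw10 : w₁ ≤ w₀ := le_max_left _ _
  have hWb : ∀ b ∈ ch w₁, W b ≤ w₀ := fun b hb => (Finset.le_sup hb).trans (le_max_right _ _)
  have hcover : ((Finset.range (p ^ w)).filter
      fun E => E % p ^ v = a ∧ g E ≠ g (E % p ^ w₀)) ⊆
      ((ch w₁).biUnion fun b => (Finset.range (p ^ w)).filter
        fun E => E % p ^ w₁ = b ∧ g E ≠ g (E % p ^ W b)) ∪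
      (ch w \ ((Finset.range (p ^ w)).filter fun E => E % p ^ w₁ ∈ ch w₁)) := by
    intro E hE
    simp only [Finset.mem_filter, Finset.mem_range] at hE
    obtain ⟨hEw, hEa, hEg⟩ := hE
    rw [Finset.mem_union]
    by_cases hE1 : E % p ^ w₁ ∈ ch w₁
    · left
      simp only [Finset.mem_biUnion, Finset.mem_filter, Finset.mem_range]
      refine ⟨_, hE1, hEw, rfl, fun h => hEg (le_antisymm ?_ (hg _ _))⟩
      rw [h]; exact hmono E (hWb _ hE1)
    · right
      simp only [Finset.mem_sdiff, Finset.mem_filter, Finset.mem_range, hch] at hE1 ⊢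
      refine ⟨⟨hEw, hEa, fun h => hEg (le_antisymm ?_ (hg _ _))⟩, fun h => hE1 h.2⟩
      rw [h, ← hs, ← hEa]
      exact hmono E (hvw₁.trans hw10)
  have h1 := Finset.card_le_card hcover
  have h2 := h1.trans (Finset.card_union_le _ _)
  have h3 : (((ch w₁).biUnion fun b => (Finset.range (p ^ w)).filter
        fun E => E % p ^ w₁ = b ∧ g E ≠ g (E % p ^ W b)).card : ℝ) ≤ ε / 2 * (p : ℝ) ^ w := by
    calc _ ≤ ((∑ b ∈ ch w₁, ((Finset.range (p ^ w)).filter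
        fun E => E % p ^ w₁ = b ∧ g E ≠ g (E % p ^ W b)).card : ℕ) : ℝ) := by
          exact_mod_cast Finset.card_biUnion_le
      _ ≤ ∑ b ∈ ch w₁, ε / (2 * (p : ℝ) ^ w₁) * (p : ℝ) ^ w := by
          rw [Nat.cast_sum]
          exact Finset.sum_le_sum fun b hb => hW b hb w ((hWb b hb).trans hw)
      _ = c w₁ * (ε / 2 * (p : ℝ) ^ w) := by
          rw [Finset.sum_const, nsmul_eq_mul, hc]
          have := (hpw w₁).ne'
          field_simp
      _ ≤ 1 * (ε / 2 * (p : ℝ) ^ w) := by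
          have := hpw w
          gcongr
          exact hc1 w₁
      _ = _ := one_mul _
  have h4 : ((ch w \ ((Finset.range (p ^ w)).filter fun E => E % p ^ w₁ ∈ ch w₁)).card : ℝ)
      ≤ ε / 2 * (p : ℝ) ^ w := by
    rw [Finset.cast_card_sdiff (hsub hvw₁ hw1), card_filter_mod_mem hp hw1 _ (hch_lt w₁)]
    have h5 := hw₁ w (hvw₁.trans hw1)
    simp only [hc] at h5
    have hw' := hpw w
    have hw1' := hpw w₁
    have e : (p : ℝ) ^ w = (p : ℝ) ^ w₁ * (p : ℝ) ^ (w - w₁) := by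
      rw [← pow_add]; congr 1; omega
    rw [div_le_iff₀ hw', add_mul] at h5
    push_cast
    have e2 : ((ch w₁).card : ℝ) / (p : ℝ) ^ w₁ * (p : ℝ) ^ w
        = (ch w₁).card * (p : ℝ) ^ (w - w₁) := by
      rw [e]; field_simp
    linarith
  have h6 := (Nat.cast_le (α := ℝ)).2 h2
  push_cast at h6
  linarith

open Classical in
/-- A function on `ℕ` with values in a partial order without infinite ascending chains, which
grows along the tree of base `p` expansions, is determined by the last digits of its argument,
up to a set of small density. -/
theorem exists_card_ne_mod_le [WellFoundedGT α] (hp : 0 < p)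
    (hg : ∀ E w, g (E % p ^ w) ≤ g E) (ε : ℝ) (hε : 0 < ε) :
    ∃ w₀, ∀ w, w₀ ≤ w →
      (((Finset.range (p ^ w)).filter fun E => g E ≠ g (E % p ^ w₀)).card : ℝ)
        ≤ ε * (p : ℝ) ^ w := by
  obtain ⟨w₀, h⟩ := exists_card_ne_mod_le_of_node hp hg (g 0) 0 0 (by simp) rfl ε hε
  refine ⟨w₀, fun w hw => ?_⟩
  have := h w hw
  simpa [Nat.mod_one] using this

open Classical in
-- A bad `a` stays bad when the digits between the length of `K` and the leading place `n` are
-- filled arbitrarily. This changes digits below the leading 1, so it is not a step in the tree and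
-- needs the full binomial hypothesis. Each bad `a` thus yields p^(n-w) bad numbers below p^(n+1),
-- whose density is already bounded.
theorem exists_card_add_pow_ne_mod_le [WellFoundedGT α] (hp : p.Prime)
    (hg : ∀ E j, ¬ p ∣ (E + j).choose j → g E ≤ g (E + j)) (ε : ℝ) (hε : 0 < ε) :
    ∃ w₀, ∀ n K, w₀ ≤ n → p ^ w₀ ≤ K → K ≤ p ^ n →
      (((Finset.range K).filter fun a => g (a + p ^ n) ≠ g (a % p ^ w₀)).card : ℝ) ≤ ε * K := by
  have hp0 := hp.pos
  have hp0' : (0 : ℝ) < p := by exact_mod_cast hp0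
  have hg' : ∀ E w, g (E % p ^ w) ≤ g E := by
    intro E w
    have e : E % p ^ w + p ^ w * (E / p ^ w) = E := Nat.mod_add_div _ _
    have := hg (E % p ^ w) (p ^ w * (E / p ^ w)) (not_dvd_choose_add_pow_mul hp _ _
      (Nat.mod_lt _ (pow_pos hp0 w)) (by simpa using hp.one_lt.ne'))
    rwa [e] at this
  -- One factor p pays for rounding `K` up to a power of p, the other for the additional leading
  -- digit.
  obtain ⟨w₀, h⟩ := exists_card_ne_mod_le hp0 hg' (ε / p ^ 2) (by positivity)
  refine ⟨w₀, fun n K hn hK hKn => ?_⟩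
  set w := Nat.clog p K with hwdef
  have hKw : K ≤ p ^ w := Nat.le_pow_clog hp.one_lt K
  have hwn : w ≤ n := (Nat.clog_le_iff_le_pow hp.one_lt).2 hKn
  have hw0 : w₀ ≤ w := (Nat.pow_le_pow_iff_right hp.one_lt).1 (hK.trans hKw)
  have hwK : p ^ w ≤ p * K := by
    rcases Nat.eq_zero_or_pos w with h0 | h0
    · rw [h0, pow_zero]
      have : 0 < K := (pow_pos hp0 w₀).trans_le hK
      exact Nat.mul_pos hp0 this
    · have h1 : ¬ K ≤ p ^ (w - 1) := fun h2 => by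
        have := (Nat.clog_le_iff_le_pow hp.one_lt).2 h2
        omega
      have h3 : p ^ w = p * p ^ (w - 1) := by rw [← pow_succ']; congr 1; omega
      rw [h3]
      exact Nat.mul_le_mul_left _ (not_le.1 h1).le
  set B := (Finset.range K).filter fun a => g (a + p ^ n) ≠ g (a % p ^ w₀) with hB
  have hBw : ∀ b ∈ B, b < p ^ w := fun b hb =>
    (Finset.mem_range.1 (Finset.mem_filter.1 hb).1).trans_le hKw
  have hinj : B.card * p ^ (n - w) ≤ ((Finset.range (p ^ (n + 1))).filter
      fun E => g E ≠ g (E % p ^ w₀)).card := by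
    rw [← card_filter_mod_mem hp0 hwn B hBw]
    refine Finset.card_le_card_of_injOn (fun E => E + p ^ n) ?_
      (fun a _ b _ hab => Nat.add_right_cancel hab)
    intro E hE
    simp only [Finset.coe_filter, Finset.mem_range, Set.mem_ofPred_eq] at hE ⊢
    obtain ⟨hEn, hEB⟩ := hE
    refine ⟨?_, fun heq => ?_⟩
    · calc E + p ^ n < p ^ n + p ^ n := by omega
        _ = p ^ n * 2 := by ring
        _ ≤ p ^ n * p := Nat.mul_le_mul_left _ hp.two_le
        _ = p ^ (n + 1) := (pow_succ _ _).symm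
    · have hbad := (Finset.mem_filter.1 hEB).2
      have e1 : E % p ^ w % p ^ w₀ = E % p ^ w₀ := Nat.mod_mod_of_dvd _ (pow_dvd_pow p hw0)
      have e2 : (E + p ^ n) % p ^ w₀ = E % p ^ w₀ := by
        obtain ⟨t, ht⟩ := pow_dvd_pow p hn
        rw [ht, Nat.add_mul_mod_self_left]
      have e3 : E % p ^ w + p ^ n + p ^ w * (E / p ^ w) = E + p ^ n := by
        have := Nat.mod_add_div E (p ^ w); omega
      have hle : g (E % p ^ w + p ^ n) ≤ g (E + p ^ n) := by
        rw [← e3]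
        refine hg _ _ ?_
        -- The last `w` digits drop out by Lucas; in what remains, the leading 1 does not overlap
        -- the digits of `E / p ^ w`.
        have e4 : E % p ^ w + p ^ n + p ^ w * (E / p ^ w)
            = E % p ^ w + p ^ w * (E / p ^ w + p ^ (n - w) * 1) := by
          have : p ^ n = p ^ w * p ^ (n - w) := by rw [← pow_add]; congr 1; omega
          rw [this]; ring
        rw [e4]
        refine not_dvd_choose_add_pow_mul hp _ _ (Nat.mod_lt _ (pow_pos hp0 w)) ?_
        have hlt : E / p ^ w < p ^ (n - w) := Nat.div_lt_of_lt_mul (by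
          rw [← pow_add]; rwa [show w + (n - w) = n by omega])
        have := not_dvd_choose_add_pow_mul hp 1 1 hlt (by simpa using hp.one_lt.ne')
        simp only [mul_one] at this ⊢
        rwa [Nat.choose_symm_add]
      rw [heq, e2] at hle
      refine hbad (le_antisymm (by rwa [e1]) ?_)
      have := hg' (E % p ^ w + p ^ n) w₀
      obtain ⟨t, ht⟩ := pow_dvd_pow p hn
      rwa [ht, Nat.add_mul_mod_self_left, ← ht] at this
  have h1 := h (n + 1) (by omega)
  have h2 : (B.card : ℝ) * (p : ℝ) ^ (n - w) ≤ ε / p ^ 2 * (p : ℝ) ^ (n + 1) :=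
    le_trans (by exact_mod_cast hinj) h1
  have h3 : (p : ℝ) ^ (n + 1) = (p : ℝ) ^ w * p * (p : ℝ) ^ (n - w) := by
    rw [← pow_succ, ← pow_add]; congr 1; omega
  have h4 : (0 : ℝ) < (p : ℝ) ^ (n - w) := by positivity
  rw [h3, ← mul_assoc, mul_le_mul_iff_left₀ h4] at h2
  have h5 : ((p ^ w : ℕ) : ℝ) ≤ ((p * K : ℕ) : ℝ) := by exact_mod_cast hwK
  push_cast at h5
  calc (B.card : ℝ) ≤ ε / p ^ 2 * ((p : ℝ) ^ w * p) := h2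
    _ ≤ ε / p ^ 2 * ((p * K) * p) := by gcongr
    _ = ε * K := by field_simp

end Tree

/-! ### Truncated sections of negative degree -/

section TwistedSum

variable {K : Type*} [CommRing K]

/-- The `k`-th coefficient of `∑ f i * T ^ (-(r + 1 + i))` after the substitution of `T - ω`
for `T`. -/
def twistedSum (r : ℕ) (ω : K) (k : ℕ) : (ℕ → K) →ₗ[K] K :=
  ∑ i ∈ Finset.range (k + 1), (((r + k).choose (k - i) : K) * ω ^ (k - i)) • LinearMap.proj i

theorem twistedSum_apply (r : ℕ) (ω : K) (k : ℕ) (f : ℕ → K) :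
    twistedSum r ω k f =
      ∑ i ∈ Finset.range (k + 1), ((r + k).choose (k - i) : K) * ω ^ (k - i) * f i := by
  simp [twistedSum]

/-- The sequence `f` moved to the right by `m` places. -/
def shiftSeq (m : ℕ) (f : ℕ → K) (i : ℕ) : K := if i < m then 0 else f (i - m)

theorem twistedSum_shiftSeq_of_lt {r : ℕ} {ω : K} {k m : ℕ} (h : k < m) (f : ℕ → K) :
    twistedSum r ω k (shiftSeq m f) = 0 := by
  rw [twistedSum_apply]
  refine Finset.sum_eq_zero fun i hi => ?_
  rw [shiftSeq, if_pos (by have := Finset.mem_range.1 hi; omega), mul_zero]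

theorem twistedSum_shiftSeq {r : ℕ} {ω : K} (m k : ℕ) (f : ℕ → K) :
    twistedSum r ω (m + k) (shiftSeq m f) = twistedSum (r + m) ω k f := by
  rw [twistedSum_apply, twistedSum_apply, add_assoc m k 1, Finset.sum_range_add]
  rw [Finset.sum_eq_zero, zero_add]
  · refine Finset.sum_congr rfl fun i _ => ?_
    rw [shiftSeq, if_neg (by omega), Nat.add_sub_add_left, Nat.add_sub_cancel_left, ← add_assoc]
  · intro i hi
    rw [shiftSeq, if_pos (Finset.mem_range.1 hi), mul_zero]

/-- The j-th divided derivative commutes with translation. Up to the common sign (-1)^j it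
multiplies T^(-(r+1+i)) by the binomial coefficient shown and by T^(-j). -/
theorem twistedSum_derivative (r j : ℕ) (ω : K) (k : ℕ) (f : ℕ → K) :
    twistedSum (r + j) ω k (fun i => ((r + i + j).choose j : K) * f i) =
      ((r + k + j).choose j : K) * twistedSum r ω k f := by
  rw [twistedSum_apply, twistedSum_apply, Finset.mul_sum]
  refine Finset.sum_congr rfl fun i hi => ?_
  have hi' : i ≤ k := Nat.lt_succ_iff.1 (Finset.mem_range.1 hi)
  have h1 : (r + j + k).choose (k - i) = (r + k + j).choose (r + i + j) := by
    rw [show r + j + k = r + k + j by omega, ← Nat.choose_symm (by omega)]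
    congr 1; omega
  have h2 : (r + k).choose (k - i) = (r + k).choose (r + i) := by
    rw [← Nat.choose_symm (by omega)]
    congr 1; omega
  have h3 := Nat.choose_mul (n := r + k + j) (k := r + i + j) (s := j) (by omega)
  rw [Nat.add_sub_cancel, Nat.add_sub_cancel] at h3
  have h4 : ((r + k + j).choose (r + i + j) : K) * ((r + i + j).choose j : K)
      = ((r + k + j).choose j : K) * ((r + k).choose (r + i) : K) := by
    exact_mod_cast congrArg (Nat.cast (R := K)) h3
  rw [h1, h2]
  linear_combination ω ^ (k - i) * f i * h4

/-- Translations compose. After exchanging the sums this is the binomial theorem for (ω + θ)^(k-i).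
-/
theorem twistedSum_add (r : ℕ) (ω θ : K) (k : ℕ) (f : ℕ → K) :
    twistedSum r (ω + θ) k f = ∑ m ∈ Finset.range (k + 1),
      ((r + k).choose (k - m) : K) * θ ^ (k - m) * twistedSum r ω m f := by
  simp only [twistedSum_apply, Finset.mul_sum]
  simp only [Finset.range_eq_Ico]
  rw [← Finset.sum_Ico_Ico_comm]
  refine Finset.sum_congr rfl fun i hi => ?_
  have hi' : i ≤ k := Nat.lt_succ_iff.1 (Finset.mem_Ico.1 hi).2
  rw [Finset.sum_Ico_eq_sum_range, add_pow, Finset.mul_sum, Finset.sum_mul,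
    show k + 1 - i = k - i + 1 by omega]
  refine Finset.sum_congr rfl fun m hm => ?_
  have hm' : m ≤ k - i := Nat.lt_succ_iff.1 (Finset.mem_range.1 hm)
  have h1 : (r + k).choose (k - (i + m)) = (r + k).choose (r + i + m) := by
    rw [← Nat.choose_symm (by omega)]
    congr 1; omega
  have h2 : (r + (i + m)).choose (i + m - i) = (r + i + m).choose (r + i) := by
    rw [← add_assoc, ← Nat.choose_symm (by omega)]
    congr 1; omega
  have h2' : (r + k).choose (k - i) = (r + k).choose (r + i) := by
    rw [← Nat.choose_symm (by omega)]
    congr 1; omega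
  have h3 := Nat.choose_mul (n := r + k) (k := r + i + m) (s := r + i) (by omega)
  rw [Nat.add_sub_cancel_left, show r + k - (r + i) = k - i by omega] at h3
  have h4 : ((r + k).choose (r + i + m) : K) * ((r + i + m).choose (r + i) : K)
      = ((r + k).choose (r + i) : K) * ((k - i).choose m : K) := by
    exact_mod_cast congrArg (Nat.cast (R := K)) h3
  rw [h1, h2, h2', show k - (i + m) = k - i - m by omega, show i + m - i = m by omega]
  linear_combination (- θ ^ (k - i - m) * ω ^ m * f i) * h4

theorem twistedSum_zero (r k : ℕ) (f : ℕ → K) : twistedSum r 0 k f = f k := by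
  rw [twistedSum_apply, Finset.sum_range_succ, Finset.sum_eq_zero]
  · simp
  · intro i hi
    have := Finset.mem_range.1 hi
    rw [zero_pow (by omega)]
    simp

theorem twistedSum_update (r k : ℕ) (ω : K) (f : ℕ → K) (s : K) :
    twistedSum r ω k (Function.update f k s) = twistedSum r ω k f - f k + s := by
  rw [twistedSum_apply, twistedSum_apply, Finset.sum_range_succ, Finset.sum_range_succ]
  rw [Finset.sum_congr rfl fun i hi => by
    rw [Function.update_of_ne (Finset.mem_range.1 hi).ne]]
  simp

theorem twistedSum_update_of_lt (r : ℕ) {k i : ℕ} (h : i < k) (ω : K) (f : ℕ → K) (s : K) :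
    twistedSum r ω i (Function.update f k s) = twistedSum r ω i f := by
  rw [twistedSum_apply, twistedSum_apply]
  refine Finset.sum_congr rfl fun l hl => ?_
  rw [Function.update_of_ne (by have := Finset.mem_range.1 hl; omega)]

end TwistedSum

/-- The elements of `A` that a power of `s` multiplies into the subalgebra `O`. -/
def Subalgebra.saturate {R A : Type*} [CommRing R] [CommRing A] [Algebra R A]
    (O : Subalgebra R A) (s : R) : Subalgebra R A where
  carrier := {a | ∃ m : ℕ, s ^ m • a ∈ O}
  mul_mem' := by
    rintro a b ⟨m, hm⟩ ⟨n, hn⟩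
    refine ⟨m + n, ?_⟩
    rw [pow_add, ← smul_mul_smul_comm]
    exact O.mul_mem hm hn
  add_mem' := by
    rintro a b ⟨m, hm⟩ ⟨n, hn⟩
    refine ⟨m + n, ?_⟩
    rw [smul_add]
    refine O.add_mem ?_ ?_
    · rw [pow_add, mul_comm, mul_smul]; exact O.smul_mem hm _
    · rw [pow_add, mul_smul]; exact O.smul_mem hn _
  algebraMap_mem' r := ⟨0, by rw [pow_zero, one_smul]; exact O.algebraMap_mem r⟩

theorem Subalgebra.mem_saturate {R A : Type*} [CommRing R] [CommRing A] [Algebra R A]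
    {O : Subalgebra R A} {s : R} {a : A} : a ∈ O.saturate s ↔ ∃ m : ℕ, s ^ m • a ∈ O := Iff.rfl

theorem Subalgebra.le_saturate {R A : Type*} [CommRing R] [CommRing A] [Algebra R A]
    (O : Subalgebra R A) (s : R) : O ≤ O.saturate s := fun a ha => ⟨0, by simpa using ha⟩

/-! ### Obstruction modules: torsion, shifts and divided derivatives -/

section Obstruction

variable {R K : Type*} [CommRing R] [CommRing K] [Algebra R K]
  (O : Fin 2 → Subalgebra R K) (ω : Fin 2 → K)

/-- The sequences whose twisted sums by `ω j` are `O j`-integral in degrees less than `k`. -/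
def integralSeq (r k : ℕ) : Submodule R (ℕ → K) where
  carrier := {f | ∀ i < k, ∀ j, twistedSum r (ω j) i f ∈ O j}
  add_mem' hf hg i hi j := by rw [map_add]; exact (O j).add_mem (hf i hi j) (hg i hi j)
  zero_mem' i _ j := by rw [map_zero]; exact (O j).zero_mem
  smul_mem' c f hf i hi j := by
    rw [LinearMap.map_smul_of_tower]; exact (O j).smul_mem (hf i hi j) c

variable (R) in
/-- The difference of the two twisted sums in degree `k`. -/
def obstruction (r k : ℕ) : (ℕ → K) →ₗ[R] K :=
  ((twistedSum r (ω 0) k) - (twistedSum r (ω 1) k)).restrictScalars R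

theorem obstruction_apply (r k : ℕ) (f : ℕ → K) :
    obstruction R ω r k f = twistedSum r (ω 0) k f - twistedSum r (ω 1) k f := rfl

/-- The sum of the two subalgebras. -/
def latticeSum : Submodule R K := Subalgebra.toSubmodule (O 0) ⊔ Subalgebra.toSubmodule (O 1)

/-- The classes of the obstructions of integral sequences modulo `latticeSum O`. -/
def obstructionModule (r k : ℕ) : Submodule R K :=
  (integralSeq O ω r k).map (obstruction R ω r k) ⊔ latticeSum O

theorem latticeSum_le_obstructionModule (r k : ℕ) : latticeSum O ≤ obstructionModule O ω r k :=
  le_sup_right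

variable {O ω} in
theorem obstruction_mem_obstructionModule {r k : ℕ} {f : ℕ → K} (hf : f ∈ integralSeq O ω r k) :
    obstruction R ω r k f ∈ obstructionModule O ω r k :=
  Submodule.mem_sup_left (Submodule.mem_map_of_mem hf)

/-- A section that starts `m` places later is a section whose first `m` coefficients vanish; the
total degree is unchanged. -/
theorem obstructionModule_le_of_shift (r m k : ℕ) :
    obstructionModule O ω (r + m) k ≤ obstructionModule O ω r (m + k) := by
  refine sup_le ?_ (latticeSum_le_obstructionModule O ω _ _)
  rintro _ ⟨f, hf, rfl⟩
  have h : shiftSeq m f ∈ integralSeq O ω r (m + k) := by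
    intro i hi j
    by_cases him : i < m
    · rw [twistedSum_shiftSeq_of_lt him]; exact (O j).zero_mem
    · obtain ⟨l, rfl⟩ := Nat.exists_eq_add_of_le (not_lt.1 him)
      rw [twistedSum_shiftSeq]
      exact hf l (by omega) j
  have := obstruction_mem_obstructionModule h
  rwa [obstruction_apply, twistedSum_shiftSeq, twistedSum_shiftSeq, ← obstruction_apply (R := R)] at this

variable {O ω}

/-- When the first translate is expanded in terms of the second, the top terms cancel, leaving
powers of `ω 0 - ω 1` and coefficients of degree below `k`, which are integral. In the application
`O'` is R[1/(xy)]. -/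
theorem obstruction_mem {O' : Subalgebra R K} (h1 : O 1 ≤ O') (hω : ω 0 - ω 1 ∈ O') {r k : ℕ}
    {f : ℕ → K} (hf : f ∈ integralSeq O ω r k) : obstruction R ω r k f ∈ O' := by
  have h := twistedSum_add r (ω 1) (ω 0 - ω 1) k f
  rw [add_sub_cancel, Finset.sum_range_succ] at h
  rw [obstruction_apply, h]
  simp only [Nat.sub_self, Nat.choose_zero_right, Nat.cast_one, pow_zero, one_mul,
    add_sub_cancel_right]
  refine O'.sum_mem fun i hi => O'.mul_mem (O'.mul_mem (natCast_mem _ _) (O'.pow_mem hω _)) ?_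
  exact h1 (hf i (Finset.mem_range.1 hi) 1)

/-- Translating back by `-ω j` shows that each `f i` with `i < k` lies in O_j[1/s] for both `j`, and
`f k` cancels in the difference. -/
theorem exists_pow_smul_obstruction_mem {s : R} (hω : ∀ j, ω j ∈ (O j).saturate s) {r k : ℕ}
    {f : ℕ → K} (hf : f ∈ integralSeq O ω r k) :
    ∃ m, s ^ m • obstruction R ω r k f ∈ latticeSum O := by
  have hfi : ∀ i < k, ∀ j, f i ∈ (O j).saturate s := by
    intro i hi j
    have h := twistedSum_add r (ω j) (-ω j) i f
    rw [add_neg_cancel, twistedSum_zero] at h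
    rw [h]
    refine Subalgebra.sum_mem _ fun l hl => Subalgebra.mul_mem _ (Subalgebra.mul_mem _
      (natCast_mem _ _) (Subalgebra.pow_mem _ (Subalgebra.neg_mem _ (hω j)) _)) ?_
    exact (O j).le_saturate s (hf l (by have := Finset.mem_range.1 hl; omega) j)
  set A : Fin 2 → K := fun j => ∑ i ∈ Finset.range k,
    ((r + k).choose (k - i) : K) * ω j ^ (k - i) * f i with hA
  have hAm : ∀ j, A j ∈ (O j).saturate s := fun j =>
    Subalgebra.sum_mem _ fun l hl => Subalgebra.mul_mem _ (Subalgebra.mul_mem _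
      (natCast_mem _ _) (Subalgebra.pow_mem _ (hω j) _)) (hfi l (Finset.mem_range.1 hl) j)
  have e : obstruction R ω r k f = A 0 - A 1 := by
    rw [obstruction_apply, twistedSum_apply, twistedSum_apply, Finset.sum_range_succ,
      Finset.sum_range_succ, hA]
    simp
  obtain ⟨m₀, h₀⟩ := hAm 0
  obtain ⟨m₁, h₁⟩ := hAm 1
  refine ⟨m₀ + m₁, ?_⟩
  rw [e, smul_sub]
  refine Submodule.sub_mem _ (Submodule.mem_sup_left ?_) (Submodule.mem_sup_right ?_)
  · rw [pow_add, mul_comm, mul_smul]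
    exact (O 0).smul_mem h₀ _
  · rw [pow_add, mul_smul]
    exact (O 1).smul_mem h₁ _

/-- The entry `f k` has coefficient 1 in both twisted sums of degree `k`, so changing it moves both
by the same amount. -/
theorem exists_update_twistedSum_mem {r k : ℕ} {f : ℕ → K}
    (hf : obstruction R ω r k f ∈ latticeSum O) :
    ∃ s, ∀ j, twistedSum r (ω j) k (Function.update f k s) ∈ O j := by
  obtain ⟨a, ha, b, hb, hab⟩ := Submodule.mem_sup.1 hf
  rw [obstruction_apply] at hab
  refine ⟨f k - twistedSum r (ω 0) k f + a, fun j => ?_⟩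
  rw [twistedSum_update]
  revert j
  rw [Fin.forall_fin_two]
  constructor
  · rw [show twistedSum r (ω 0) k f - f k + (f k - twistedSum r (ω 0) k f + a) = a by ring]
    exact ha
  · rw [show twistedSum r (ω 1) k f - f k + (f k - twistedSum r (ω 0) k f + a) = -b by
      linear_combination hab]
    exact (O 1).neg_mem hb

variable {p N : ℕ}

/-- The divided derivative multiplies the obstruction by a binomial coefficient prime to p, which is
invertible on classes killed by p^N. -/
theorem obstructionModule_le_of_derivative (hp : p.Prime)
    (hT : ∀ r k, ∀ f ∈ integralSeq O ω r k,
      (p : R) ^ N • obstruction R ω r k f ∈ latticeSum O)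
    {r k j : ℕ} (hj : ¬ p ∣ (r + k + j).choose j) :
    obstructionModule O ω r k ≤ obstructionModule O ω (r + j) k := by
  refine sup_le ?_ (latticeSum_le_obstructionModule O ω _ _)
  rintro _ ⟨f, hf, rfl⟩
  have hf' : (fun i => ((r + i + j).choose j : K) * f i) ∈ integralSeq O ω (r + j) k := by
    intro i hi l
    rw [twistedSum_derivative]
    exact (O l).mul_mem (natCast_mem _ _) (hf i hi l)
  have h := obstruction_mem_obstructionModule hf'
  rw [obstruction_apply, twistedSum_derivative, twistedSum_derivative, ← mul_sub,
    ← obstruction_apply (R := R)] at h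
  have hcop : IsCoprime (((r + k + j).choose j : ℕ) : ℤ) ((p ^ N : ℕ) : ℤ) :=
    Nat.isCoprime_iff_coprime.2 (Nat.Coprime.pow_right _ ((hp.coprime_iff_not_dvd.2 hj).symm))
  obtain ⟨u, v, huv⟩ := hcop
  have huv' : (u : R) * ((r + k + j).choose j : R) + v * (p : R) ^ N = 1 := by
    exact_mod_cast congrArg (Int.cast (R := R)) huv
  have e : obstruction R ω r k f = (u : R) •
      (((r + k + j).choose j : K) * obstruction R ω r k f) +
      (v : R) • ((p : R) ^ N • obstruction R ω r k f) := by
    have e1 : ((r + k + j).choose j : K) * obstruction R ω r k f =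
      ((r + k + j).choose j : R) • obstruction R ω r k f := by
      rw [Algebra.smul_def, map_natCast]
    rw [e1, smul_smul, smul_smul, ← add_smul, huv', one_smul]
  rw [e]
  exact Submodule.add_mem _ (Submodule.smul_mem _ _ h) (Submodule.smul_mem _ _
    (latticeSum_le_obstructionModule O ω _ _ (hT r k f hf)))

theorem obstructionModule_zero_le (hp : p.Prime)
    (hT : ∀ r k, ∀ f ∈ integralSeq O ω r k,
      (p : R) ^ N • obstruction R ω r k f ∈ latticeSum O)
    {E j : ℕ} (hj : ¬ p ∣ (E + j).choose j) :
    obstructionModule O ω 0 E ≤ obstructionModule O ω 0 (E + j) := by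
  have h1 := obstructionModule_le_of_derivative hp hT (r := 0) (k := E) (j := j) (by simpa using hj)
  have h2 := obstructionModule_le_of_shift O ω 0 j E
  rw [add_comm E j]
  exact h1.trans h2

/-- With E = m + p^w, take a derivative of order E - E % p^w, a multiple of p^w, so that Lucas
applies, and then shift by p^w - E % p^w places. -/
theorem obstructionModule_mod_le (hp : p.Prime)
    (hT : ∀ r k, ∀ f ∈ integralSeq O ω r k,
      (p : R) ^ N • obstruction R ω r k f ∈ latticeSum O) {w m : ℕ} :
    obstructionModule O ω 0 ((m + p ^ w) % p ^ w) ≤ obstructionModule O ω m (p ^ w) := by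
  set E := m + p ^ w with hE
  have hw : 0 < p ^ w := pow_pos hp.pos w
  have hlt : E % p ^ w < p ^ w := Nat.mod_lt _ hw
  have hme := Nat.mod_add_div E (p ^ w)
  have h1 := obstructionModule_le_of_derivative hp hT (r := 0) (k := E % p ^ w)
    (j := p ^ w * (E / p ^ w)) (by
      rw [zero_add]
      exact not_dvd_choose_add_pow_mul hp _ _ hlt (by simpa using hp.one_lt.ne'))
  have h2 := obstructionModule_le_of_shift O ω m (p ^ w - E % p ^ w) (E % p ^ w)
  rw [show p ^ w - E % p ^ w + E % p ^ w = p ^ w by omega] at h2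
  rw [show 0 + p ^ w * (E / p ^ w) = m + (p ^ w - E % p ^ w) by omega] at h1
  exact h1.trans h2

end Obstruction

/-! ### Removing obstructions degree by degree -/

section ObstructionRemoval

variable {R K : Type*} [CommRing R] [Field K] [Algebra R K]
  {O : Fin 2 → Subalgebra R K} {ω : Fin 2 → K} {p N : ℕ}

/-- Modulo `latticeSum O` all obstructions are multiples of `μ`, so inclusions can be tested on
ideals of R. This brings in the ascending chain condition. -/
theorem obstructionModule_le_of_comap_le {μ : K}
    (hμ : ∀ r k, ∀ f ∈ integralSeq O ω r k,
      obstruction R ω r k f ∈ latticeSum O ⊔ Submodule.span R {μ})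
    {r k : ℕ} {M : Submodule R K} (hM : latticeSum O ≤ M)
    (h : (obstructionModule O ω r k).comap (LinearMap.toSpanSingleton R K μ) ≤
      M.comap (LinearMap.toSpanSingleton R K μ)) :
    obstructionModule O ω r k ≤ M := by
  refine sup_le ?_ hM
  rintro _ ⟨f, hf, rfl⟩
  obtain ⟨w, hw, _, hs, e⟩ := Submodule.mem_sup.1 (hμ r k f hf)
  obtain ⟨c, rfl⟩ := Submodule.mem_span_singleton.1 hs
  rw [← e]
  refine M.add_mem (hM hw) (h (show c • μ ∈ obstructionModule O ω r k from ?_))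
  rw [← sub_eq_iff_eq_add'.2 e.symm]
  exact Submodule.sub_mem _ (obstruction_mem_obstructionModule hf)
    (latticeSum_le_obstructionModule O ω _ _ hw)

theorem exists_integralSeq_obstruction_mem {r l h : ℕ} {f : ℕ → K}
    (hf : f ∈ integralSeq O ω r (l + h))
    (hob : obstruction R ω r (l + h) f ∈ obstructionModule O ω (r + l) h) :
    ∃ f' ∈ integralSeq O ω r (l + h), (∀ i < l, f' i = f i) ∧
      (∀ i < l, ∀ j, twistedSum r (ω j) i f' = twistedSum r (ω j) i f) ∧
      obstruction R ω r (l + h) f' ∈ latticeSum O := by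
  obtain ⟨_, ⟨t, ht, rfl⟩, w, hw, e⟩ := Submodule.mem_sup.1 hob
  refine ⟨f - shiftSeq l t, fun i hi j => ?_, fun i hi => ?_, fun i hi j => ?_, ?_⟩
  · rw [map_sub]
    refine (O j).sub_mem (hf i hi j) ?_
    by_cases hil : i < l
    · rw [twistedSum_shiftSeq_of_lt hil]; exact (O j).zero_mem
    · obtain ⟨m, rfl⟩ := Nat.exists_eq_add_of_le (not_lt.1 hil)
      rw [twistedSum_shiftSeq]
      exact ht m (by omega) j
  · simp [shiftSeq, hi]
  · rw [map_sub, twistedSum_shiftSeq_of_lt hi, sub_zero]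
  · rw [map_sub, ← e]
    rw [obstruction_apply ω r (l + h) (shiftSeq l t), twistedSum_shiftSeq, twistedSum_shiftSeq,
      ← obstruction_apply (R := R), add_sub_cancel_left]
    exact hw

open Classical in
-- Each bad degree costs a factor p^N, and `e` is the total exponent so far. A good degree changes
-- the sequence only from place `k - h` on, where `hcount` gives `e ≤ c i`: no divisibility has to
-- be preserved there.
theorem exists_seq_of_bad_count
    (hT : ∀ r k, ∀ f ∈ integralSeq O ω r k,
      (p : R) ^ N • obstruction R ω r k f ∈ latticeSum O)
    {r κ h q : ℕ} {c : ℕ → ℕ} (hc : Monotone c) (hκ : h < κ) (bad : ℕ → Prop)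
    (hstart : ∃ f ∈ integralSeq O ω r κ, f 0 = 1)
    (hgood : ∀ k, κ ≤ k → k ≤ q → ¬ bad k → ∀ f ∈ integralSeq O ω r k,
      obstruction R ω r k f ∈ obstructionModule O ω (r + (k - h)) h)
    (hcount : ∀ k, κ ≤ k → k ≤ q →
      N * ((Finset.range (k + 1)).filter fun i => κ ≤ i ∧ bad i).card ≤ c (k - h))
    (k : ℕ) (hk : κ ≤ k) : k ≤ q + 1 → ∃ f : ℕ → K, ∃ e : ℕ,
      e = N * ((Finset.range k).filter fun i => κ ≤ i ∧ bad i).card ∧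
      f 0 = (p : K) ^ e ∧
      ∀ i < k, ∀ j, ∃ o ∈ O j, twistedSum r (ω j) i f = (p : K) ^ (e - c i) * o := by
  induction k, hk using Nat.le_induction with
  | base =>
    intro _
    obtain ⟨f, hf, hf0⟩ := hstart
    refine ⟨f, 0, ?_, by simpa using hf0, fun i hi j => ⟨_, hf i hi j, by simp⟩⟩
    rw [Finset.filter_false_of_mem, Finset.card_empty, mul_zero]
    intro i hi h
    have := Finset.mem_range.1 hi
    omega
  | succ k hk ih =>
    intro hkq
    have hkq' : k ≤ q := by omega
    obtain ⟨f, e, he, hf0, hf⟩ := ih (by omega)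
    have hfP : f ∈ integralSeq O ω r k := fun i hi j => by
      obtain ⟨o, ho, h⟩ := hf i hi j
      rw [h]
      exact (O j).mul_mem ((O j).pow_mem (natCast_mem _ _) _) ho
    obtain ⟨e', he'⟩ :
        ∃ e', e' = N * ((Finset.range (k + 1)).filter fun i => κ ≤ i ∧ bad i).card := ⟨_, rfl⟩
    have hcnt := hcount k hk hkq'
    rw [← he'] at hcnt
    obtain ⟨f', hf0', hfk', hob'⟩ : ∃ f' : ℕ → K, f' 0 = (p : K) ^ e' ∧
        (∀ i < k, ∀ j, ∃ o ∈ O j, twistedSum r (ω j) i f' = (p : K) ^ (e' - c i) * o) ∧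
        obstruction R ω r k f' ∈ latticeSum O := by
      rw [Finset.range_add_one, Finset.filter_insert] at he'
      by_cases hb : bad k
      · rw [if_pos ⟨hk, hb⟩, Finset.card_insert_of_notMem (by simp), mul_add, ← he, mul_one] at he'
        refine ⟨(p : R) ^ N • f, ?_, fun i hi j => ?_, ?_⟩
        · rw [Pi.smul_apply, hf0, Algebra.smul_def, he', map_pow, map_natCast, pow_add, mul_comm]
        · obtain ⟨o, ho, h⟩ := hf i hi j
          refine ⟨(p : K) ^ (e - c i + N - (e' - c i)) * o,
            (O j).mul_mem ((O j).pow_mem (natCast_mem _ _) _) ho, ?_⟩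
          rw [LinearMap.map_smul_of_tower, h, Algebra.smul_def, map_pow, map_natCast,
            ← mul_assoc, ← mul_assoc, ← pow_add, ← pow_add]
          congr 2
          omega
        · rw [map_smul]
          exact hT r k f hfP
      · rw [if_neg (fun h => hb h.2), ← he] at he'
        have hkl : k - h + h = k := by omega
        have hg := hgood k hk hkq' hb f hfP
        rw [← hkl] at hfP
        obtain ⟨f', hf', hfe, hfi, hob⟩ := exists_integralSeq_obstruction_mem hfP (by
          rw [hkl]; exact hg)
        rw [hkl] at hob hf'
        refine ⟨f', by rw [hfe 0 (by omega), hf0, he'], fun i hi j => ?_, hob⟩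
        by_cases hil : i < k - h
        · rw [hfi i hil j, he']
          exact hf i hi j
        · refine ⟨_, hf' i hi j, ?_⟩
          rw [Nat.sub_eq_zero_of_le (hcnt.trans (hc (not_lt.1 hil))), pow_zero, one_mul]
    obtain ⟨s, hs⟩ := exists_update_twistedSum_mem hob'
    refine ⟨Function.update f' k s, e', he', ?_, fun i hi j => ?_⟩
    · rw [Function.update_of_ne (by omega), hf0']
    · rcases Nat.lt_succ_iff_lt_or_eq.1 hi with hi | rfl
      · rw [twistedSum_update_of_lt r hi]
        exact hfk' i hi j
      · refine ⟨_, hs j, ?_⟩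
        rw [Nat.sub_eq_zero_of_le (hcnt.trans (hc (Nat.sub_le _ _))), pow_zero, one_mul]

/-- The product of this binomial coefficient with `i` is divisible by p^n, and the p-adic valuation
of `i` is less than `κ`. -/
theorem pow_dvd_choose_pow_sub_one_add {p : ℕ} (hp : p.Prime) {n κ i : ℕ} (h0 : 0 < i) (hi : i < κ) :
    p ^ (n - κ) ∣ (p ^ n - 1 + i).choose i := by
  obtain ⟨i, rfl⟩ := Nat.exists_eq_add_one.2 h0
  have hq : 0 < p ^ n := pow_pos hp.pos n
  have h3 : p ^ n ∣ (p ^ n - 1 + (i + 1)).choose (i + 1) * (i + 1) := by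
    have e := Nat.choose_succ_right_eq (p ^ n - 1 + (i + 1)) i
    rw [show p ^ n - 1 + (i + 1) - i = p ^ n by omega] at e
    rw [e]
    exact dvd_mul_left _ _
  by_cases hnκ : n ≤ κ
  · rw [Nat.sub_eq_zero_of_le hnκ, pow_zero]; exact one_dvd _
  obtain ⟨t, m, hm, e⟩ := Nat.exists_eq_pow_mul_and_not_dvd (n := i + 1) (by omega) p hp.one_lt.ne'
  have ht : t < κ := by
    have : p ^ t ≤ i + 1 := Nat.le_of_dvd (by omega) (e ▸ dvd_mul_right _ _)
    exact (Nat.lt_pow_self hp.one_lt).trans_le this |>.trans hi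
  have h4 : p ^ (n - κ) * p ^ t ∣ (p ^ n - 1 + (i + 1)).choose (i + 1) * m * p ^ t := by
    rw [mul_assoc, mul_comm m, ← e, ← pow_add]
    exact (pow_dvd_pow p (by omega)).trans h3
  have h5 := Nat.dvd_of_mul_dvd_mul_right (pow_pos hp.pos t) h4
  exact (Nat.Coprime.pow_left _ (hp.coprime_iff_not_dvd.2 hm)).dvd_of_dvd_mul_right h5

/-- The initial section is T^(-p^n): its binomial coefficients absorb the denominators p^(Ni) of the
powers of `ω j`. -/
theorem exists_integralSeq_pow_sub_one (hp : p.Prime) (hω : ∀ j, (p : R) ^ N • ω j ∈ O j)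
    {n κ : ℕ} (hn : N * κ + κ ≤ n) : ∃ f ∈ integralSeq O ω (p ^ n - 1) κ, f 0 = 1 := by
  refine ⟨Pi.single 0 1, fun i hi j => ?_, by simp⟩
  have e : twistedSum (p ^ n - 1) (ω j) i (Pi.single 0 1)
      = ((p ^ n - 1 + i).choose i : K) * ω j ^ i := by
    rw [twistedSum_apply, Finset.sum_eq_single 0]
    · simp
    · intro l _ hl; rw [Pi.single_eq_of_ne hl, mul_zero]
    · simp
  rw [e]
  rcases Nat.eq_zero_or_pos i with rfl | h0
  · simp
  have hd : p ^ (N * i) ∣ (p ^ n - 1 + i).choose i := by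
    refine (pow_dvd_pow p ?_).trans (pow_dvd_choose_pow_sub_one_add hp h0 hi)
    have := Nat.mul_le_mul_left N hi.le
    omega
  obtain ⟨m, hm⟩ := hd
  have : ((p ^ n - 1 + i).choose i : K) * ω j ^ i = m * ((p : R) ^ N • ω j) ^ i := by
    rw [hm, Algebra.smul_def, mul_pow]
    push_cast [map_pow, map_natCast]
    ring
  rw [this]
  exact (O j).mul_mem (natCast_mem _ _) ((O j).pow_mem (hω j) _)

open Classical in
theorem exists_seq_pow_mul_twistedSum_mem [IsNoetherianRing R] (hp : p.Prime) (hpK : (p : K) ≠ 0)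
    (hT : ∀ r k, ∀ f ∈ integralSeq O ω r k,
      (p : R) ^ N • obstruction R ω r k f ∈ latticeSum O)
    (hω : ∀ j, (p : R) ^ N • ω j ∈ O j) {μ : K}
    (hμ : ∀ r k, ∀ f ∈ integralSeq O ω r k,
      obstruction R ω r k f ∈ latticeSum O ⊔ Submodule.span R {μ})
    {a b : ℕ} (ha : 0 < a) (hb : 0 < b) :
    ∃ n, ∃ f : ℕ → K, f 0 = 1 ∧ ∀ k ≤ p ^ n, ∀ j,
      (p : K) ^ (a * k / b) * twistedSum (p ^ n - 1) (ω j) k f ∈ O j := by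
  set g : ℕ → Ideal R := fun E =>
    (obstructionModule O ω 0 E).comap (LinearMap.toSpanSingleton R K μ) with hgdef
  have hg : ∀ E j, ¬ p ∣ (E + j).choose j → g E ≤ g (E + j) := fun E j h =>
    Submodule.comap_mono (obstructionModule_zero_le hp hT h)
  -- The factor 1/2 pays for the delay `h`, because k - h ≥ k/2 for k ≥ 2h + 1; the factor 1/(N + 1)
  -- pays for p^N at each bad degree.
  obtain ⟨w, hw⟩ := exists_card_add_pow_ne_mod_le hp hg ((a : ℝ) / (2 * b * (N + 1)))
    (by positivity)
  set h := p ^ w with hh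
  have hh0 : 0 < h := pow_pos hp.pos w
  set κ := 2 * h + 1 with hκ
  -- The part Nκ + κ makes the initial section integral below `κ`; the summand `w` makes `h` divide
  -- `q`.
  set n := N * κ + κ + w with hn
  set q := p ^ n with hq
  have hq0 : 0 < q := pow_pos hp.pos n
  have hκq : κ ≤ q := (show κ ≤ n by omega).trans (Nat.lt_pow_self hp.one_lt).le
  have hhq : h ∣ q := pow_dvd_pow p (by omega)
  set c : ℕ → ℕ := fun k => a * k / b with hc
  have hcm : Monotone c := fun k l hkl => Nat.div_le_div_right (Nat.mul_le_mul_left _ hkl)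
  set bad : ℕ → Prop := fun k => g (k - 1 + q) ≠ g ((k - 1) % h) with hbad
  obtain ⟨f, e, -, hf0, hf⟩ := exists_seq_of_bad_count (r := q - 1) (κ := κ) (h := h) (q := q)
    hT hcm (by omega) bad
    (exists_integralSeq_pow_sub_one hp hω (by omega)) (by
      intro k hk hkq hb f hf
      -- Writing Ob for the obstruction modules: Ob(q-1, k) ⊆ Ob(0, k-1+q) ⊆ Ob(0, (k-1) % h) ⊆
      -- Ob(q-1+(k-h), h), by a shift, by goodness of `k`, and by `obstructionModule_mod_le`.
      have hb' : g (k - 1 + q) = g ((k - 1) % h) := not_not.1 hb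
      have h1 := obstructionModule_le_of_shift O ω 0 (q - 1) k
      rw [zero_add, show q - 1 + k = k - 1 + q by omega] at h1
      have h2 := obstructionModule_le_of_comap_le hμ (latticeSum_le_obstructionModule O ω _ _)
        hb'.le
      have h3 := obstructionModule_mod_le hp hT (w := w) (m := q - 1 + (k - h))
      have h4 : (q - 1 + (k - h) + h) % h = (k - 1) % h := by
        rw [show q - 1 + (k - h) + h = k - 1 + q by omega]
        obtain ⟨t, ht⟩ := hhq
        rw [ht, Nat.add_mul_mod_self_left]
      rw [← hh, h4] at h3
      exact h3 (h2 (h1 (obstruction_mem_obstructionModule hf)))) (by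
      intro k hk hkq
      rw [hc, Nat.le_div_iff_mul_le hb]
      have hcard : ((Finset.range (k + 1)).filter fun i => κ ≤ i ∧ bad i).card ≤
          ((Finset.range k).filter fun i => g (i + q) ≠ g (i % h)).card := by
        refine Finset.card_le_card_of_injOn (fun i => i - 1) ?_ ?_
        · intro i hi
          simp only [Finset.coe_filter, Finset.mem_range, Set.mem_ofPred_eq] at hi ⊢
          exact ⟨by omega, hi.2.2⟩
        · intro i hi l hl hil
          simp only [Finset.coe_filter, Finset.mem_range, Set.mem_ofPred_eq] at hi hl hil
          omega
      have h1 := hw n k (by omega) (by omega) hkq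
      have h2 : (((Finset.range (k + 1)).filter fun i => κ ≤ i ∧ bad i).card : ℝ) ≤
          a / (2 * b * (N + 1)) * k := le_trans (by exact_mod_cast hcard) h1
      have hk2 : (k : ℝ) / 2 ≤ ((k - h : ℕ) : ℝ) := by
        have : k ≤ 2 * (k - h) := by omega
        have : (k : ℝ) ≤ 2 * ((k - h : ℕ) : ℝ) := by exact_mod_cast this
        linarith
      have hb0 : (0 : ℝ) < b := by exact_mod_cast hb
      have hN : (0 : ℝ) ≤ N := Nat.cast_nonneg N
      have : (N : ℝ) * ((Finset.range (k + 1)).filter fun i => κ ≤ i ∧ bad i).card * b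
          ≤ a * ((k - h : ℕ) : ℝ) := by
        calc _ ≤ ((N : ℝ) + 1) * (a / (2 * b * (N + 1)) * k) * b := by gcongr; linarith
          _ = a * (k / 2) := by field_simp
          _ ≤ _ := by gcongr
      have hnat : N * ((Finset.range (k + 1)).filter fun i => κ ≤ i ∧ bad i).card * b
          ≤ a * (k - h) := by exact_mod_cast this
      convert hnat) (q + 1) (by omega) le_rfl
  refine ⟨n, ((p : K) ^ e)⁻¹ • f, ?_, fun k hk j => ?_⟩
  · rw [Pi.smul_apply, hf0, smul_eq_mul, inv_mul_cancel₀ (pow_ne_zero _ hpK)]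
  · obtain ⟨o, ho, ho'⟩ := hf k (by omega) j
    rw [map_smul, ho', smul_eq_mul]
    have : (p : K) ^ (a * k / b) * (((p : K) ^ e)⁻¹ * ((p : K) ^ (e - c k) * o))
        = (p : K) ^ (c k + (e - c k) - e) * o := by
      have h1 : (p : K) ^ (c k + (e - c k) - e) * (p : K) ^ e = p ^ (c k) * p ^ (e - c k) := by
        rw [← pow_add, ← pow_add]; congr 1; omega
      have h2 := pow_ne_zero e hpK
      field_simp
      linear_combination (-o) * h1
    rw [this]
    exact (O j).mul_mem ((O j).pow_mem (natCast_mem _ _) _) ho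

end ObstructionRemoval

/-! ### Inversion of sections and integral equations -/

section Inversion

open Polynomial in
theorem exists_polynomial_mul_sub_one_dvd {K : Type*} [Field K] {f : ℕ → K} (hf : f 0 = 1)
    (q : ℕ) : ∃ φ ψ : K[X], φ.natDegree ≤ q ∧ ψ.natDegree ≤ q ∧ (∀ i ≤ q, φ.coeff i = f i) ∧
      ψ.coeff 0 = 1 ∧ X ^ (q + 1) ∣ φ * ψ - 1 := by
  set F : PowerSeries K := PowerSeries.mk f with hF
  have hF0 : PowerSeries.constantCoeff F ≠ 0 := by
    rw [← PowerSeries.coeff_zero_eq_constantCoeff_apply, hF, PowerSeries.coeff_mk, hf]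
    exact one_ne_zero
  have hmul := PowerSeries.mul_inv_cancel F hF0
  have hdeg : ∀ G : PowerSeries K, (PowerSeries.trunc (q + 1) G).natDegree ≤ q := fun G =>
    Nat.lt_succ_iff.1 (PowerSeries.natDegree_trunc_lt G q)
  have hcoeff : ∀ (G : PowerSeries K), ∀ i ≤ q, (PowerSeries.trunc (q + 1) G).coeff i
      = PowerSeries.coeff i G := fun G i hi => by
    rw [PowerSeries.coeff_trunc, if_pos (by omega)]
  refine ⟨PowerSeries.trunc (q + 1) F, PowerSeries.trunc (q + 1) F⁻¹, hdeg _, hdeg _,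
    fun i hi => by rw [hcoeff _ i hi, hF, PowerSeries.coeff_mk], ?_, ?_⟩
  · rw [hcoeff _ 0 (Nat.zero_le _), PowerSeries.coeff_zero_eq_constantCoeff_apply,
      PowerSeries.constantCoeff_inv, ← PowerSeries.coeff_zero_eq_constantCoeff_apply, hF,
      PowerSeries.coeff_mk, hf, inv_one]
  · rw [Polynomial.X_pow_dvd_iff]
    intro d hd
    rw [Polynomial.coeff_sub, Polynomial.coeff_mul]
    have h := congrArg (PowerSeries.coeff d) hmul
    rw [PowerSeries.coeff_mul] at h
    rw [Finset.sum_congr rfl fun x hx => by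
      have := Finset.HasAntidiagonal.mem_antidiagonal.1 hx
      rw [hcoeff _ x.1 (by omega), hcoeff _ x.2 (by omega)], h, PowerSeries.coeff_one,
      Polynomial.coeff_one, sub_eq_zero]

variable {K : Type*} [Field K]

/-- The power series `1 / (1 - ω X)`. -/
noncomputable def geometricSeries (ω : K) : PowerSeries K :=
  PowerSeries.rescale ω (PowerSeries.mk 1)

theorem one_sub_mul_geometricSeries (ω : K) :
    (1 - PowerSeries.C ω * PowerSeries.X) * geometricSeries ω = 1 := by
  have h := congrArg (PowerSeries.rescale ω) (PowerSeries.mk_one_mul_one_sub_eq_one K)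
  rw [map_mul, map_sub, map_one, PowerSeries.rescale_X] at h
  rw [mul_comm]
  exact h

theorem coeff_geometricSeries_pow (ω : K) (d n : ℕ) :
    PowerSeries.coeff n (geometricSeries ω ^ (d + 1)) = ((d + n).choose d : K) * ω ^ n := by
  rw [geometricSeries, ← map_pow, PowerSeries.coeff_rescale,
    PowerSeries.mk_one_pow_eq_mk_choose_add, PowerSeries.coeff_mk, mul_comm]

open Polynomial in
-- In the variable X = 1/T, replacing T by T - ω sends X to X/(1 - ωX); the factor `geometricSeries
-- ω ^ q` comes from T^(-q).
theorem coeff_geometricSeries_mul_aeval (ω : K) (φ : K[X]) {q : ℕ} (hq : 0 < q)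
    (k : ℕ) :
    PowerSeries.coeff k (geometricSeries ω ^ q *
      aeval (PowerSeries.X * geometricSeries ω) φ) = twistedSum (q - 1) ω k φ.coeff := by
  rw [aeval_eq_sum_range' (n := φ.natDegree + k + 1) (by omega), Finset.mul_sum, map_sum,
    twistedSum_apply, ← Finset.sum_subset (s₁ := Finset.range (k + 1))]
  · refine Finset.sum_congr rfl fun i hi => ?_
    have hi' : i ≤ k := Nat.lt_succ_iff.1 (Finset.mem_range.1 hi)
    have e : geometricSeries ω ^ q * φ.coeff i • (PowerSeries.X * geometricSeries ω) ^ i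
        = φ.coeff i • (PowerSeries.X ^ i * geometricSeries ω ^ (q - 1 + i + 1)) := by
      rw [show q - 1 + i + 1 = q + i by omega, mul_smul_comm, mul_pow, pow_add]
      congr 1; ring
    rw [e, PowerSeries.coeff_smul, PowerSeries.coeff_X_pow_mul', if_pos hi',
      coeff_geometricSeries_pow, show q - 1 + i + (k - i) = q - 1 + k by omega,
      ← Nat.choose_symm (by omega), show q - 1 + k - (q - 1 + i) = k - i by omega, smul_eq_mul]
    ring
  · intro i; simp only [Finset.mem_range]; omega
  · intro i _ hi
    have hi' : ¬ i ≤ k := fun h => hi (Finset.mem_range.2 (by omega))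
    rw [mul_smul_comm, mul_pow, mul_left_comm, PowerSeries.coeff_smul,
      PowerSeries.coeff_X_pow_mul', if_neg hi', smul_zero]

open Polynomial in
/-- The polynomial `(1 - ω X) ^ q * ψ (X / (1 - ω X))`. -/
noncomputable def homogenizedComp (ω : K) (q : ℕ) (ψ : K[X]) : K[X] :=
  ∑ i ∈ Finset.range (q + 1), C (ψ.coeff i) * X ^ i * (1 - C ω * X) ^ (q - i)

open Polynomial in
theorem natDegree_homogenizedComp_le (ω : K) (q : ℕ) (ψ : K[X]) :
    (homogenizedComp ω q ψ).natDegree ≤ q := by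
  refine natDegree_sum_le_of_forall_le _ _ fun i hi => ?_
  have hi' : i ≤ q := Nat.lt_succ_iff.1 (Finset.mem_range.1 hi)
  refine natDegree_mul_le_of_le (natDegree_C_mul_X_pow_le _ _)
    (natDegree_pow_le_of_le (q - i) (m := 1) ?_) |>.trans (by omega)
  compute_degree

open Polynomial in
theorem coe_homogenizedComp (ω : K) {q : ℕ} {ψ : K[X]} (hψ : ψ.natDegree ≤ q) :
    (homogenizedComp ω q ψ : PowerSeries K) = (1 - PowerSeries.C ω * PowerSeries.X) ^ q *
      aeval (PowerSeries.X * geometricSeries ω) ψ := by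
  rw [aeval_eq_sum_range' (n := q + 1) (by omega), Finset.mul_sum, homogenizedComp,
    ← Polynomial.coeToPowerSeries.ringHom_apply, map_sum]
  refine Finset.sum_congr rfl fun i hi => ?_
  have hi' : i ≤ q := Nat.lt_succ_iff.1 (Finset.mem_range.1 hi)
  simp only [map_mul, map_pow, map_sub, map_one, Polynomial.coeToPowerSeries.ringHom_apply,
    Polynomial.coe_C, Polynomial.coe_X]
  have h : (1 - PowerSeries.C ω * PowerSeries.X) ^ q * geometricSeries ω ^ i
      = (1 - PowerSeries.C ω * PowerSeries.X) ^ (q - i) := by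
    conv_lhs => rw [show q = q - i + i by omega]
    rw [pow_add, mul_assoc, ← mul_pow, one_sub_mul_geometricSeries, one_pow, mul_one]
  rw [← h, PowerSeries.smul_eq_C_mul, mul_pow]
  ring

open Polynomial in
-- Substituting X/(1 - ωX) in φψ ≡ 1 modulo X^(q+1) shows that the translates are again inverse to
-- each other up to degree q.
theorem sum_twistedSum_mul_coeff_homogenizedComp (ω : K) {q : ℕ} (hq : 0 < q) {φ ψ : K[X]}
    (hψ : ψ.natDegree ≤ q) (h : X ^ (q + 1) ∣ φ * ψ - 1) {m : ℕ} (hm : m ≤ q) :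
    ∑ x ∈ Finset.HasAntidiagonal.antidiagonal m, twistedSum (q - 1) ω x.1 φ.coeff *
      (homogenizedComp ω q ψ).coeff x.2 = if m = 0 then 1 else 0 := by
  obtain ⟨e, he⟩ := h
  have h1 : (geometricSeries ω ^ q * aeval (PowerSeries.X * geometricSeries ω) φ) *
      (homogenizedComp ω q ψ : PowerSeries K) = 1 + PowerSeries.X ^ (q + 1) *
        (geometricSeries ω ^ (q + 1) * aeval (PowerSeries.X * geometricSeries ω) e) := by
    have h2 := congrArg (aeval (PowerSeries.X * geometricSeries ω)) he
    rw [map_sub, map_mul, map_one, map_mul, map_pow, aeval_X] at h2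
    have h3 : ((1 - PowerSeries.C ω * PowerSeries.X) * geometricSeries ω) ^ q = 1 := by
      rw [one_sub_mul_geometricSeries, one_pow]
    rw [mul_pow] at h3 h2
    rw [coe_homogenizedComp ω hψ]
    linear_combination (aeval (PowerSeries.X * geometricSeries ω) φ *
      aeval (PowerSeries.X * geometricSeries ω) ψ) * h3 + h2
  have h4 := congrArg (PowerSeries.coeff m) h1
  rw [PowerSeries.coeff_mul, map_add, PowerSeries.coeff_X_pow_mul', if_neg (by omega),
    PowerSeries.coeff_one, add_zero] at h4
  rw [← h4]
  refine Finset.sum_congr rfl fun x _ => ?_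
  rw [coeff_geometricSeries_mul_aeval ω φ hq, Polynomial.coeff_coe]

theorem twistedSum_congr {r k : ℕ} {ω : K} {f g : ℕ → K} (h : ∀ i ≤ k, f i = g i) :
    twistedSum r ω k f = twistedSum r ω k g := by
  rw [twistedSum_apply, twistedSum_apply]
  exact Finset.sum_congr rfl fun i hi => by rw [h i (Nat.lt_succ_iff.1 (Finset.mem_range.1 hi))]

open Polynomial in
theorem coeff_zero_homogenizedComp (ω : K) (q : ℕ) (ψ : K[X]) :
    (homogenizedComp ω q ψ).coeff 0 = ψ.coeff 0 := by
  rw [coeff_zero_eq_eval_zero, homogenizedComp, eval_finsetSum, Finset.sum_range_succ',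
    Finset.sum_eq_zero]
  · simp [coeff_zero_eq_eval_zero]
  · intro i _; simp

open Polynomial in
-- The recursion for the coefficients of an inverse series preserves the bounds because k ↦ ⌊ak/b⌋
-- is superadditive.
theorem pow_mul_coeff_homogenizedComp_mem {R : Type*} [CommRing R] [Algebra R K]
    (O : Subalgebra R K) (ω : K) {p q : ℕ} (hq : 0 < q) {φ ψ : K[X]} (hψ : ψ.natDegree ≤ q)
    (hφ0 : φ.coeff 0 = 1) (hψ0 : ψ.coeff 0 = 1) (h : X ^ (q + 1) ∣ φ * ψ - 1) {a b : ℕ}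
    (hO : ∀ k ≤ q, (p : K) ^ (a * k / b) * twistedSum (q - 1) ω k φ.coeff ∈ O) (m : ℕ)
    (hm : m ≤ q) : (p : K) ^ (a * m / b) * (homogenizedComp ω q ψ).coeff m ∈ O := by
  induction m using Nat.strong_induction_on with
  | _ m ih =>
  rcases Nat.eq_zero_or_pos m with rfl | hm0
  · rw [coeff_zero_homogenizedComp, hψ0, mul_zero, Nat.zero_div, pow_zero, mul_one]
    exact O.one_mem
  have h1 := sum_twistedSum_mul_coeff_homogenizedComp ω hq hψ h hm
  rw [if_neg hm0.ne', ← Finset.add_sum_erase _ _ (show (0, m) ∈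
    Finset.HasAntidiagonal.antidiagonal m by simp)] at h1
  have h2 : twistedSum (q - 1) ω 0 φ.coeff = 1 := by simp [twistedSum_apply, hφ0]
  rw [h2, one_mul, add_eq_zero_iff_eq_neg] at h1
  rw [h1, mul_neg, Finset.mul_sum]
  refine O.neg_mem (O.sum_mem fun x hx => ?_)
  obtain ⟨hx0, hxm⟩ := Finset.mem_erase.1 hx
  rw [Finset.HasAntidiagonal.mem_antidiagonal] at hxm
  have hx1 : x.1 ≠ 0 := fun h0 => hx0 (Prod.ext h0 (by simp only; omega))
  have h3 : a * x.1 / b + a * x.2 / b ≤ a * m / b := by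
    rw [← hxm, mul_add]; exact Nat.div_add_div_le_add_div
  have e : (p : K) ^ (a * m / b) * (twistedSum (q - 1) ω x.1 φ.coeff *
      (homogenizedComp ω q ψ).coeff x.2) = (p : K) ^ (a * m / b - (a * x.1 / b + a * x.2 / b)) *
        (((p : K) ^ (a * x.1 / b) * twistedSum (q - 1) ω x.1 φ.coeff) *
        ((p : K) ^ (a * x.2 / b) * (homogenizedComp ω q ψ).coeff x.2)) := by
    conv_lhs => rw [← Nat.sub_add_cancel h3]
    rw [pow_add, pow_add]
    ring
  rw [e]
  exact O.mul_mem (O.pow_mem (natCast_mem _ _) _)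
    (O.mul_mem (hO _ (by omega)) (ih _ (by omega) (by omega)))

end Inversion

section Root

variable {R K L : Type*} [CommRing R] [Field K] [Algebra R K] [Field L] [Algebra R L]
  [Algebra K L]

open Polynomial in
-- Let τ be a root of T^q ψ(1/T). Then τ + ω_j is a root of the translated polynomial, and scaling
-- by ρ^a multiplies its k-th coefficient by ρ^(ak) = ρ^(ak mod b) p^⌊ak/b⌋.
theorem exists_root_mem [IsAlgClosed L] {O : Fin 2 → Subalgebra R K} {ω : Fin 2 → K}
    {S : Fin 2 → Subalgebra R L} (hOS : ∀ j, ∀ t ∈ O j, algebraMap K L t ∈ S j)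
    (hS : ∀ j, ∀ (q : ℕ) (c : ℕ → L) (ζ : L), c 0 = 1 → (∀ k ≤ q, c k ∈ S j) →
      ∑ k ∈ Finset.range (q + 1), c k * ζ ^ (q - k) = 0 → ζ ∈ S j)
    {p q a b : ℕ} (hq : 0 < q) {ρ : L} (hρ : ρ ^ b = p) (hρS : ∀ j, ρ ∈ S j)
    {f : ℕ → K} (hf0 : f 0 = 1)
    (hf : ∀ k ≤ q, ∀ j, (p : K) ^ (a * k / b) * twistedSum (q - 1) (ω j) k f ∈ O j) :
    ∃ τ : L, ∀ j, ρ ^ a * (τ + algebraMap K L (ω j)) ∈ S j := by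
  obtain ⟨φ, ψ, hφ, hψ, hφf, hψ0, hdvd⟩ := exists_polynomial_mul_sub_one_dvd hf0 q
  have hφ0 : φ.coeff 0 = 1 := by rw [hφf 0 (Nat.zero_le _), hf0]
  set F : L[X] := ∑ i ∈ Finset.range (q + 1), C (algebraMap K L (ψ.coeff i)) * X ^ (q - i)
    with hF
  have hFq : F.coeff q = 1 := by
    rw [hF, finsetSum_coeff, Finset.sum_eq_single 0]
    · simp [hψ0]
    · intro i hi hi0
      rw [coeff_C_mul, coeff_X_pow, if_neg (by have := Finset.mem_range.1 hi; omega), mul_zero]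
    · simp
  have hFdeg : F.degree ≠ 0 := fun h => by
    have := Polynomial.coeff_eq_zero_of_natDegree_lt (p := F) (n := q)
      (by rw [natDegree_eq_of_degree_eq_some h]; exact hq)
    rw [hFq] at this
    exact one_ne_zero this
  obtain ⟨τ, hτ⟩ := IsAlgClosed.exists_root F hFdeg
  refine ⟨τ, fun j => ?_⟩
  set τ' := τ + algebraMap K L (ω j) with hτ'
  by_cases h0 : τ' = 0
  · rw [h0, mul_zero]; exact (S j).zero_mem
  set P := homogenizedComp (ω j) q ψ with hP
  have hPO := pow_mul_coeff_homogenizedComp_mem (O j) (ω j) hq hψ hφ0 hψ0 hdvd (fun k hk => by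
    rw [twistedSum_congr (fun i hi => hφf i (hi.trans hk))]
    exact hf k hk j)
  have hsum : ∑ k ∈ Finset.range (q + 1), algebraMap K L (P.coeff k) * τ' ^ (q - k) = 0 := by
    have h1 : τ' ^ q * aeval τ'⁻¹ P = 0 := by
      rw [hP, homogenizedComp, map_sum, Finset.mul_sum]
      rw [IsRoot.def, hF, eval_finsetSum] at hτ
      rw [← hτ]
      refine Finset.sum_congr rfl fun i hi => ?_
      have hi' : i ≤ q := Nat.lt_succ_iff.1 (Finset.mem_range.1 hi)
      simp only [map_mul, map_pow, map_sub, map_one, aeval_C, aeval_X, eval_mul, eval_C, eval_pow,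
        eval_X]
      have h2 : τ' * (1 - algebraMap K L (ω j) * τ'⁻¹) = τ := by
        rw [mul_sub, mul_one, mul_left_comm, mul_inv_cancel₀ h0, mul_one, hτ']
        ring
      conv_rhs => rw [← h2, mul_pow]
      conv_lhs => rw [← Nat.sub_add_cancel hi', pow_add, Nat.sub_add_cancel hi']
      have h3 : τ' ^ i * τ'⁻¹ ^ i = 1 := by rw [← mul_pow, mul_inv_cancel₀ h0, one_pow]
      linear_combination (τ' ^ (q - i) * algebraMap K L (ψ.coeff i) *
        (1 - algebraMap K L (ω j) * τ'⁻¹) ^ (q - i)) * h3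
    rw [aeval_eq_sum_range' (n := q + 1)
      (Nat.lt_succ_iff.2 (natDegree_homogenizedComp_le _ _ _)), Finset.mul_sum] at h1
    rw [← h1]
    refine Finset.sum_congr rfl fun k hk => ?_
    have hk' : k ≤ q := Nat.lt_succ_iff.1 (Finset.mem_range.1 hk)
    conv_rhs => rw [← Nat.sub_add_cancel hk', pow_add, Nat.sub_add_cancel hk']
    have h3 : τ' ^ k * τ'⁻¹ ^ k = 1 := by rw [← mul_pow, mul_inv_cancel₀ h0, one_pow]
    rw [Algebra.smul_def]
    linear_combination (- τ' ^ (q - k) * algebraMap K L (P.coeff k)) * h3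
  refine hS j q (fun k => ρ ^ (a * k) * algebraMap K L (P.coeff k)) _ ?_ (fun k hk => ?_) ?_
  · rw [hP, coeff_zero_homogenizedComp, hψ0]; simp
  · have e : ρ ^ (a * k) * algebraMap K L (P.coeff k) = ρ ^ (a * k % b) *
        algebraMap K L ((p : K) ^ (a * k / b) * P.coeff k) := by
      rw [map_mul, map_pow, map_natCast, ← hρ, ← pow_mul, ← mul_assoc, ← pow_add, Nat.mod_add_div]
    rw [e]
    exact (S j).mul_mem ((S j).pow_mem (hρS j) _) (hOS j _ (hPO k hk))
  · have e : ∀ k ∈ Finset.range (q + 1), ρ ^ (a * k) * algebraMap K L (P.coeff k) *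
        (ρ ^ a * τ') ^ (q - k) = ρ ^ (a * q) * (algebraMap K L (P.coeff k) * τ' ^ (q - k)) := by
      intro k hk
      have hk' : k ≤ q := Nat.lt_succ_iff.1 (Finset.mem_range.1 hk)
      rw [mul_pow, ← pow_mul]
      have : ρ ^ (a * q) = ρ ^ (a * k) * ρ ^ (a * (q - k)) := by
        rw [← pow_add, ← mul_add, Nat.add_sub_cancel' hk']
      rw [this]; ring
    rw [Finset.sum_congr rfl e, ← Finset.mul_sum, hsum, mul_zero]

end Root

section IntegralClosure

theorem isIntegral_of_sum_eq_zero {A L : Type*} [CommRing A] [CommRing L] [Algebra A L] {q : ℕ}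
    {c : ℕ → L} {ζ : L} (hc0 : c 0 = 1) (hc : ∀ k ≤ q, IsIntegral A (c k))
    (h : ∑ k ∈ Finset.range (q + 1), c k * ζ ^ (q - k) = 0) : IsIntegral A ζ := by
  classical
  let B := integralClosure A L
  choose! d hd using fun (k : ℕ) (hk : k ≤ q) => (⟨⟨c k, hc k hk⟩, rfl⟩ : ∃ b : B, (b : L) = c k)
  have : IsIntegral B ζ := by
    refine ⟨Polynomial.X ^ q + ∑ k ∈ Finset.range q,
      Polynomial.C (d (k + 1)) * Polynomial.X ^ (q - (k + 1)), ?_, ?_⟩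
    · refine Polynomial.monic_X_pow_add ?_
      refine (Polynomial.degree_sum_le _ _).trans_lt ?_
      rw [Finset.sup_lt_iff (by exact WithBot.bot_lt_coe q)]
      intro k hk
      refine (Polynomial.degree_C_mul_X_pow_le _ _).trans_lt ?_
      have := Finset.mem_range.1 hk
      exact_mod_cast (by omega : q - (k + 1) < q)
    · rw [Finset.sum_range_succ', hc0, one_mul, Nat.sub_zero] at h
      rw [Polynomial.eval₂_add, Polynomial.eval₂_pow, Polynomial.eval₂_X,
        Polynomial.eval₂_finsetSum, add_comm, ← h]
      congr 1
      refine Finset.sum_congr rfl fun k hk => ?_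
      rw [Polynomial.eval₂_mul, Polynomial.eval₂_pow, Polynomial.eval₂_X, Polynomial.eval₂_C,
        ← hd (k + 1) (Finset.mem_range.1 hk)]
      rfl
  exact isIntegral_trans ζ this

/-- A single power s^M clears all denominators: s^M ζ satisfies the equation with coefficients
s^(Mk) c_k. -/
theorem mem_saturate_integralClosure_of_sum_eq_zero {R L : Type*} [CommRing R] [CommRing L]
    [Algebra R L] {s : R} {q : ℕ} {c : ℕ → L} {ζ : L} (hc0 : c 0 = 1)
    (hc : ∀ k ≤ q, c k ∈ (integralClosure R L).saturate s)
    (h : ∑ k ∈ Finset.range (q + 1), c k * ζ ^ (q - k) = 0) :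
    ζ ∈ (integralClosure R L).saturate s := by
  choose! m hm using fun (k : ℕ) (hk : k ≤ q) => Subalgebra.mem_saturate.1 (hc k hk)
  set M := (Finset.range (q + 1)).sup m with hM
  refine Subalgebra.mem_saturate.2 ⟨M, ?_⟩
  refine isIntegral_of_sum_eq_zero (q := q) (c := fun k => s ^ (M * k) • c k) (by simpa using hc0)
    (fun k hk => ?_) ?_
  · rcases Nat.eq_zero_or_pos k with rfl | hk0
    · simp only [mul_zero, pow_zero, one_smul, hc0]; exact isIntegral_one
    · have h1 : m k ≤ M * k := (Finset.le_sup (f := m) (Finset.mem_range.2 (by omega))).trans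
        (Nat.le_mul_of_pos_right _ hk0)
      rw [← Nat.sub_add_cancel h1, pow_add, mul_smul]
      exact (hm k hk : IsIntegral R _).smul _
  · have e : ∀ k ∈ Finset.range (q + 1), s ^ (M * k) • c k * (s ^ M • ζ) ^ (q - k)
        = s ^ (M * q) • (c k * ζ ^ (q - k)) := by
      intro k hk
      have hk' : k ≤ q := Nat.lt_succ_iff.1 (Finset.mem_range.1 hk)
      rw [smul_pow, smul_mul_smul_comm, ← pow_mul, ← pow_add, ← mul_add, Nat.add_sub_cancel' hk']
    rw [Finset.sum_congr rfl e, ← Finset.smul_sum, h, smul_zero]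

end IntegralClosure

/-! ### Normal domains and Koszul homology -/

section Normal

variable {R K : Type*} [CommRing R] [IsDomain R] [IsNoetherianRing R] [IsIntegrallyClosed R]
  [Field K] [Algebra R K] [IsFractionRing R K]

/-- Otherwise an associated prime P = (R : b) of K/R contains I. If bP ⊆ P, then b is integral over
R, hence in R. If tb ∉ P for some t ∈ P, then P is minimal over (t), against height at least 2. -/
theorem exists_algebraMap_eq_of_height_two_le {I : Ideal R} (hI : 2 ≤ I.height) {a : K}
    (ha : ∀ r ∈ I, ∃ m : ℕ, r ^ m • a ∈ (⊥ : Subalgebra R K)) : a ∈ (⊥ : Subalgebra R K) := by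
  by_contra hna
  set M₀ : Submodule R K := Subalgebra.toSubmodule (⊥ : Subalgebra R K) with hM₀
  have hmk : ∀ c : K, (Submodule.Quotient.mk c : K ⧸ M₀) = 0 ↔ c ∈ (⊥ : Subalgebra R K) := fun c =>
    Submodule.Quotient.mk_eq_zero _
  obtain ⟨P, hP, hle⟩ := exists_le_isAssociatedPrime_of_isNoetherianRing (R := R)
    (Submodule.Quotient.mk a : K ⧸ M₀) (fun h => hna ((hmk a).1 h))
  obtain ⟨hPp, bq, hb⟩ := isAssociatedPrime_iff.1 hP
  obtain ⟨b, rfl⟩ := Submodule.Quotient.mk_surjective _ bq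
  have hPb : ∀ r, r ∈ P ↔ r • b ∈ (⊥ : Subalgebra R K) := fun r => by
    rw [hb, Submodule.mem_colon_singleton, Submodule.mem_bot, ← Submodule.Quotient.mk_smul, hmk]
  have hIP : I ≤ P := fun r hr => by
    obtain ⟨m, hm⟩ := ha r hr
    refine hPp.mem_of_pow_mem m (hle ?_)
    rw [Submodule.mem_colon_singleton, Submodule.mem_bot, ← Submodule.Quotient.mk_smul, hmk]
    exact hm
  have hPheight : 2 ≤ P.height := hI.trans (Ideal.height_mono hIP)
  have hPbot : P ≠ ⊥ := by
    rintro rfl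
    rw [Ideal.height_bot] at hPheight
    exact absurd hPheight (by norm_num)
  have hb1 : b ∉ (⊥ : Subalgebra R K) := fun h =>
    hPp.ne_top ((Ideal.eq_top_iff_one _).2 ((hPb 1).2 (by rwa [one_smul])))
  by_cases hcase : ∀ t ∈ P, ∃ u ∈ P, algebraMap R K u = t • b
  · refine hb1 (Algebra.mem_bot.2 (IsIntegrallyClosed.isIntegral_iff.1 ?_))
    refine isIntegral_of_smul_mem_submodule (M := K) (Submodule.map (Algebra.linearMap R K) P) ?_
      ((IsNoetherian.noetherian P).map _) b ?_
    · intro h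
      refine hPbot (Submodule.map_injective_of_injective (f := Algebra.linearMap R K)
        (IsFractionRing.injective R K) (h.trans (Submodule.map_bot _).symm))
    · rintro _ ⟨t, ht, rfl⟩
      obtain ⟨u, hu, e⟩ := hcase t ht
      refine ⟨u, hu, ?_⟩
      rw [Algebra.linearMap_apply, e, Algebra.linearMap_apply, Algebra.smul_def, smul_eq_mul,
        mul_comm]
  · push Not at hcase
    obtain ⟨t, ht, hu⟩ := hcase
    obtain ⟨u, hut⟩ := Algebra.mem_bot.1 ((hPb t).1 ht)
    have huP : u ∉ P := fun h => hu u h hut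
    have hmin : P ∈ (Ideal.span {t}).minimalPrimes := by
      refine ⟨⟨hPp, (Ideal.span_singleton_le_iff_mem _).2 ht⟩, ?_⟩
      rintro Q ⟨hQ, htQ⟩ hQP r hr
      obtain ⟨v, hv⟩ := Algebra.mem_bot.1 ((hPb r).1 hr)
      have e : r * u = t * v := by
        apply IsFractionRing.injective R K
        rw [map_mul, map_mul, hut, hv, Algebra.smul_def, Algebra.smul_def]
        ring
      have h1 : r * u ∈ Q := by
        rw [e]
        exact Q.mul_mem_right _ ((Ideal.span_singleton_le_iff_mem _).1 htQ)
      exact (hQ.mem_or_mem h1).resolve_right fun h => huP (hQP h)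
    have := Ideal.height_le_one_of_isPrincipal_of_mem_minimalPrimes _ P hmin
    exact absurd (hPheight.trans this) (by norm_num)

theorem mem_bot_of_mem_saturate {x y : R} (hxy : 2 ≤ (Ideal.span {x, y}).height) {a : K}
    (hx : a ∈ (⊥ : Subalgebra R K).saturate x) (hy : a ∈ (⊥ : Subalgebra R K).saturate y) :
    a ∈ (⊥ : Subalgebra R K) := by
  obtain ⟨m, hm⟩ := Subalgebra.mem_saturate.1 hx
  obtain ⟨n, hn⟩ := Subalgebra.mem_saturate.1 hy
  refine exists_algebraMap_eq_of_height_two_le hxy fun r hr => ?_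
  obtain ⟨u, v, rfl⟩ := Ideal.mem_span_pair.1 hr
  refine ⟨m + n, ?_⟩
  rw [add_pow, Finset.sum_smul]
  refine Subalgebra.sum_mem _ fun i hi => ?_
  rcases le_total m i with h | h
  · obtain ⟨c, hc⟩ : x ^ m ∣ (u * x) ^ i * (v * y) ^ (m + n - i) * ((m + n).choose i : R) :=
      ((pow_dvd_pow x h).trans (pow_dvd_pow_of_dvd (dvd_mul_left x u) i)).mul_right _ |>.mul_right _
    rw [hc, mul_comm, mul_smul]
    exact Subalgebra.smul_mem _ hm _
  · obtain ⟨c, hc⟩ : y ^ n ∣ (u * x) ^ i * (v * y) ^ (m + n - i) * ((m + n).choose i : R) :=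
      (((pow_dvd_pow y (by omega)).trans
        (pow_dvd_pow_of_dvd (dvd_mul_left y v) (m + n - i))).mul_left _).mul_right _
    rw [hc, mul_comm, mul_smul]
    exact Subalgebra.smul_mem _ hn _

/-- The coefficients of the minimal polynomial of `f` lie in R[1/x] ∩ R[1/y], which is R. -/
theorem isIntegral_of_mem_saturate {L : Type*} [Field L] [Algebra R L] [Algebra K L]
    [IsScalarTower R K L] {x y : R} (hx0 : x ≠ 0) (hy0 : y ≠ 0)
    (hxy : 2 ≤ (Ideal.span {x, y}).height) {f : L}
    (hx : f ∈ (integralClosure R L).saturate x) (hy : f ∈ (integralClosure R L).saturate y) :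
    IsIntegral R f := by
  have hcoeff : ∀ s : R, s ≠ 0 → f ∈ (integralClosure R L).saturate s →
      IsIntegral K f ∧ ∀ i, (minpoly K f).coeff i ∈ (⊥ : Subalgebra R K).saturate s := by
    intro s hs hf
    obtain ⟨m, hm⟩ := Subalgebra.mem_saturate.1 hf
    have hm' : IsIntegral R (s ^ m • f) := hm
    have hsK : algebraMap R K (s ^ m) ≠ 0 :=
      (map_ne_zero_iff _ (IsFractionRing.injective R K)).2 (pow_ne_zero m hs)
    have e1 : s ^ m • f = algebraMap R K (s ^ m) • f := (algebraMap_smul K (s ^ m) f).symm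
    have hfK : IsIntegral K f := by
      have h1 : IsIntegral K (algebraMap R K (s ^ m) • f) := e1 ▸ hm'.tower_top
      have h2 := h1.smul (algebraMap R K (s ^ m))⁻¹
      rwa [smul_smul, inv_mul_cancel₀ hsK, one_smul] at h2
    refine ⟨hfK, fun i => ?_⟩
    have h3 := IsIntegrallyClosed.minpoly_smul hsK hfK
    rw [← e1, minpoly.isIntegrallyClosed_eq_field_fractions' K hm'] at h3
    have h4 := congrArg (fun P => Polynomial.coeff P i) h3
    simp only [Polynomial.coeff_map, Polynomial.coeff_scaleRoots] at h4
    refine Subalgebra.mem_saturate.2 ⟨m * ((minpoly K f).natDegree - i), Algebra.mem_bot.2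
      ⟨_, h4.trans ?_⟩⟩
    rw [Algebra.smul_def, pow_mul, map_pow (algebraMap R K) (s ^ m), mul_comm]
  obtain ⟨hfK, hcx⟩ := hcoeff x hx0 hx
  obtain ⟨-, hcy⟩ := hcoeff y hy0 hy
  have hlift : minpoly K f ∈ Polynomial.lifts (algebraMap R K) :=
    (Polynomial.lifts_iff_coeff_lifts _).2 fun i =>
      Algebra.mem_bot.1 (mem_bot_of_mem_saturate hxy (hcx i) (hcy i))
  obtain ⟨P, hP, -, hPm⟩ := Polynomial.lifts_and_natDegree_eq_and_monic hlift
    (minpoly.monic hfK)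
  refine ⟨P, hPm, ?_⟩
  rw [IsScalarTower.algebraMap_eq R K L, ← Polynomial.eval₂_map, hP]
  exact minpoly.aeval K f

end Normal

section Koszul

/-- The relation is a Koszul 1-cycle (E, -α, -β), and the first coordinate of a boundary lies in (X,
Y). -/
theorem exists_mul_eq_of_kills_koszulH1 {R : Type u} [CommRing R] {r P X Y : R}
    (h : Kills r (KoszulH1 ![P, X, Y])) {E α β : R} (hE : P * E = X * α + Y * β) :
    ∃ s t, r * E = X * s + Y * t := by
  have hker : ![E, -α, -β] ∈ LinearMap.ker (koszulD1 ![P, X, Y]) := by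
    rw [LinearMap.mem_ker]
    simp [koszulD1, Fintype.linearCombination_apply, Fin.sum_univ_three]
    linear_combination hE
  have h1 := h (Submodule.Quotient.mk ⟨_, hker⟩)
  rw [← Submodule.Quotient.mk_smul, Submodule.Quotient.mk_eq_zero, Submodule.submoduleOf,
    Submodule.mem_comap] at h1
  obtain ⟨v, hv⟩ := h1
  have h2 := congrFun hv 0
  simp [koszulD2, dotProduct, Fin.sum_univ_three] at h2
  exact ⟨-v 0, -v 1, by linear_combination -h2⟩

end Koszul

/-! ### The pair of localizations and the main theorem -/

section Lattice

variable {R K : Type*} [CommRing R] [Field K] [Algebra R K]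

theorem Subalgebra.pow_smul_mem_of_le {A : Type*} [CommRing A] [Algebra R A] {O : Subalgebra R A}
    {s : R} {a : A} {k l : ℕ} (hkl : k ≤ l) (h : s ^ k • a ∈ O) : s ^ l • a ∈ O := by
  rw [← Nat.sub_add_cancel hkl, pow_add, mul_smul]
  exact O.smul_mem h _

theorem Subalgebra.saturate_le_saturate_of_dvd {A : Type*} [CommRing A] [Algebra R A]
    (O : Subalgebra R A) {s t : R} (h : s ∣ t) : O.saturate s ≤ O.saturate t := by
  obtain ⟨c, rfl⟩ := h
  rintro a ⟨m, hm⟩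
  refine ⟨m, ?_⟩
  rw [mul_comm, mul_pow, mul_smul]
  exact O.smul_mem hm _

theorem algebraMap_div_pow_mem_saturate {s : R} (hs : algebraMap R K s ≠ 0) (r : R) (l : ℕ) :
    algebraMap R K r / algebraMap R K s ^ l ∈ (⊥ : Subalgebra R K).saturate s :=
  ⟨l, Algebra.mem_bot.2 ⟨r, by rw [Algebra.smul_def, map_pow]; field_simp⟩⟩

/-- The two localizations `R[1/y]` and `R[1/x]` inside `K`. -/
def localizationPair (K : Type*) [Field K] [Algebra R K] (x y : R) : Fin 2 → Subalgebra R K :=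
  ![(⊥ : Subalgebra R K).saturate y, (⊥ : Subalgebra R K).saturate x]

theorem mem_latticeSum_localizationPair {x y : R} {a b : K}
    (ha : a ∈ (⊥ : Subalgebra R K).saturate y) (hb : b ∈ (⊥ : Subalgebra R K).saturate x) :
    a + b ∈ latticeSum (localizationPair K x y) :=
  Submodule.add_mem_sup (S := Subalgebra.toSubmodule _) (T := Subalgebra.toSubmodule _) ha hb

theorem exists_add_of_mem_latticeSum {x y : R} {c : K}
    (hc : c ∈ latticeSum (localizationPair K x y)) :
    ∃ a ∈ (⊥ : Subalgebra R K).saturate y, ∃ b ∈ (⊥ : Subalgebra R K).saturate x, a + b = c :=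
  Submodule.mem_sup.1 hc

/-- Clearing denominators by (xy)^l turns membership in R[1/y] + R[1/x] into membership in (x^l,
y^l), to which the Koszul condition applies. -/
theorem smul_mem_latticeSum (hinj : Function.Injective (algebraMap R K)) {x y : R}
    (hx : algebraMap R K x ≠ 0) (hy : algebraMap R K y ≠ 0) {P r : R}
    (hr : ∀ l, 0 < l → ∀ E α β, P ^ l * E = x ^ l * α + y ^ l * β →
      ∃ s t, r * E = x ^ l * s + y ^ l * t) {κ : K}
    (hκ : κ ∈ (⊥ : Subalgebra R K).saturate (x * y)) {m : ℕ}
    (hm : P ^ m • κ ∈ latticeSum (localizationPair K x y)) :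
    r • κ ∈ latticeSum (localizationPair K x y) := by
  obtain ⟨l₁, h₁⟩ := Subalgebra.mem_saturate.1 hκ
  obtain ⟨o₁, ho₁, o₂, ho₂, ho⟩ := exists_add_of_mem_latticeSum hm
  obtain ⟨l₂, h₂⟩ := Subalgebra.mem_saturate.1 ho₁
  obtain ⟨l₃, h₃⟩ := Subalgebra.mem_saturate.1 ho₂
  set l := l₁ + l₂ + l₃ + m + 1 with hl
  obtain ⟨E, hE⟩ := Algebra.mem_bot.1 (Subalgebra.pow_smul_mem_of_le (l := l) (by omega) h₁)
  obtain ⟨α, hα⟩ := Algebra.mem_bot.1 (Subalgebra.pow_smul_mem_of_le (l := l) (by omega) h₂)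
  obtain ⟨β, hβ⟩ := Algebra.mem_bot.1 (Subalgebra.pow_smul_mem_of_le (l := l) (by omega) h₃)
  rw [Algebra.smul_def, map_pow] at hE hα hβ ho
  rw [map_mul] at hE
  obtain ⟨s, t, hst⟩ := hr l (by omega) E (P ^ (l - m) * α) (P ^ (l - m) * β) (by
    apply hinj
    simp only [map_mul, map_add, map_pow]
    rw [hE, hα, hβ]
    have e : algebraMap R K P ^ l = algebraMap R K P ^ (l - m) * algebraMap R K P ^ m := by
      rw [← pow_add]; congr 1; omega
    rw [e, mul_pow]
    linear_combination (-(algebraMap R K P ^ (l - m)) * algebraMap R K x ^ l *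
      algebraMap R K y ^ l) * ho)
  have e : r • κ = algebraMap R K s / algebraMap R K y ^ l +
      algebraMap R K t / algebraMap R K x ^ l := by
    have h := congrArg (algebraMap R K) hst
    simp only [map_mul, map_add, map_pow] at h
    rw [hE, mul_pow] at h
    have hx' := pow_ne_zero l hx
    have hy' := pow_ne_zero l hy
    rw [Algebra.smul_def]
    field_simp
    linear_combination h
  rw [e]
  exact mem_latticeSum_localizationPair (algebraMap_div_pow_mem_saturate hy _ _)
    (algebraMap_div_pow_mem_saturate hx _ _)

/-- Write xκ = a₁ + a₂ and yκ = b₁ + b₂. Then c = xb₂ - ya₂ lies in R[1/x] ∩ R[1/y] = R, and κ =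
b₁/y + a₂/x + c/(xy). -/
theorem mem_latticeSum_sup_span {x y : R} (hx : algebraMap R K x ≠ 0) (hy : algebraMap R K y ≠ 0)
    (hR : ∀ a : K, a ∈ (⊥ : Subalgebra R K).saturate x → a ∈ (⊥ : Subalgebra R K).saturate y →
      a ∈ (⊥ : Subalgebra R K)) {κ : K}
    (hκx : x • κ ∈ latticeSum (localizationPair K x y))
    (hκy : y • κ ∈ latticeSum (localizationPair K x y)) :
    κ ∈ latticeSum (localizationPair K x y) ⊔
      Submodule.span R {(algebraMap R K (x * y))⁻¹} := by
  obtain ⟨a₁, ha₁, a₂, ha₂, ha⟩ := exists_add_of_mem_latticeSum hκx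
  obtain ⟨b₁, hb₁, b₂, hb₂, hb⟩ := exists_add_of_mem_latticeSum hκy
  rw [Algebra.smul_def] at ha hb
  have hinv : ∀ {s : R}, algebraMap R K s ≠ 0 →
      (algebraMap R K s)⁻¹ ∈ (⊥ : Subalgebra R K).saturate s := fun {s} hs => by
    simpa using algebraMap_div_pow_mem_saturate hs 1 1
  obtain ⟨c, hc⟩ := Algebra.mem_bot.1 (hR (algebraMap R K x * b₂ - algebraMap R K y * a₂)
    (Subalgebra.sub_mem _ (Subalgebra.mul_mem _ (Subalgebra.algebraMap_mem _ _) hb₂)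
      (Subalgebra.mul_mem _ (Subalgebra.algebraMap_mem _ _) ha₂)) (by
    have : algebraMap R K x * b₂ - algebraMap R K y * a₂ =
        algebraMap R K y * a₁ - algebraMap R K x * b₁ := by
      linear_combination algebraMap R K x * hb - algebraMap R K y * ha
    rw [this]
    exact (Subalgebra.sub_mem _ (Subalgebra.mul_mem _ (Subalgebra.algebraMap_mem _ _) ha₁)
      (Subalgebra.mul_mem _ (Subalgebra.algebraMap_mem _ _) hb₁))))
  refine Submodule.mem_sup.2 ⟨_, mem_latticeSum_localizationPair
    (Subalgebra.mul_mem _ (hinv hy) hb₁) (Subalgebra.mul_mem _ (hinv hx) ha₂), _,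
    Submodule.smul_mem _ c (Submodule.mem_span_singleton_self _), ?_⟩
  rw [Algebra.smul_def, hc, map_mul]
  field_simp
  linear_combination algebraMap R K x * hb

end Lattice

section Main

variable {R : Type u} [CommRing R] [IsDomain R] [IsNoetherianRing R] [IsIntegrallyClosed R]

theorem exists_seq_of_kills_koszulH1 (K : Type*) [Field K] [Algebra R K] [IsFractionRing R K]
    {p : ℕ} (hp : p.Prime) (hp0 : (p : R) ≠ 0) {x y : R} (hx0 : x ≠ 0)
    (hy0 : y ≠ 0) (hxy : 2 ≤ (Ideal.span {x, y}).height) {N : ℕ}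
    (hkill : ∀ m : ℕ, 0 < m →
      Kills ((p : R) ^ N) (KoszulH1 ![(p : R) ^ m, x ^ m, y ^ m]) ∧
      Kills x (KoszulH1 ![(p : R) ^ m, x ^ m, y ^ m]) ∧
      Kills y (KoszulH1 ![(p : R) ^ m, x ^ m, y ^ m]))
    {z : R} (hz : (p : R) ^ N * z ∈ Ideal.span {x, y}) {a b : ℕ} (ha : 0 < a) (hb : 0 < b) :
    ∃ ω : Fin 2 → K, ω 0 - ω 1 = algebraMap R K z / algebraMap R K (x * y) ^ 1 ∧
      ∃ n, ∃ f : ℕ → K, f 0 = 1 ∧ ∀ k ≤ p ^ n, ∀ j,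
        (p : K) ^ (a * k / b) * twistedSum (p ^ n - 1) (ω j) k f ∈ localizationPair K x y j := by
  have hinj : Function.Injective (algebraMap R K) := IsFractionRing.injective R K
  have hxK : algebraMap R K x ≠ 0 := (map_ne_zero_iff _ hinj).2 hx0
  have hyK : algebraMap R K y ≠ 0 := (map_ne_zero_iff _ hinj).2 hy0
  have hpK : (p : K) ≠ 0 := by
    rw [← map_natCast (algebraMap R K)]; exact (map_ne_zero_iff _ hinj).2 hp0
  have hR : ∀ a : K, a ∈ (⊥ : Subalgebra R K).saturate x → a ∈ (⊥ : Subalgebra R K).saturate y →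
      a ∈ (⊥ : Subalgebra R K) := fun a => mem_bot_of_mem_saturate hxy
  obtain ⟨u, v, huv⟩ := Ideal.mem_span_pair.1 hz
  have huvK := congrArg (algebraMap R K) huv
  simp only [map_mul, map_add, map_pow, map_natCast] at huvK
  set O := localizationPair K x y with hO
  set ω : Fin 2 → K := ![algebraMap R K u / (algebraMap R K y * (p : K) ^ N),
    -algebraMap R K v / (algebraMap R K x * (p : K) ^ N)] with hω
  have hpN := pow_ne_zero N hpK
  have hω₀ : ω 0 = algebraMap R K u / (algebraMap R K y * (p : K) ^ N) := rfl
  have hω₁ : ω 1 = -algebraMap R K v / (algebraMap R K x * (p : K) ^ N) := rfl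
  have hθ : ω 0 - ω 1 = algebraMap R K z / algebraMap R K (x * y) ^ 1 := by
    simp only [hω₀, hω₁, map_mul, pow_one]
    field_simp
    linear_combination huvK
  have hωO : ∀ j, (p : R) ^ N • ω j ∈ O j := by
    rw [Fin.forall_fin_two]
    constructor
    · have e : (p : R) ^ N • ω 0 = algebraMap R K u / algebraMap R K y ^ 1 := by
        simp only [hω₀, Algebra.smul_def, map_pow, map_natCast, pow_one]
        field_simp
      rw [e]
      exact algebraMap_div_pow_mem_saturate hyK _ _
    · have e : (p : R) ^ N • ω 1 = algebraMap R K (-v) / algebraMap R K x ^ 1 := by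
        simp only [hω₁, Algebra.smul_def, map_pow, map_natCast, pow_one,
          map_neg]
        field_simp
      rw [e]
      exact algebraMap_div_pow_mem_saturate hxK _ _
  have hxyK : algebraMap R K (x * y) ≠ 0 := by rw [map_mul]; exact mul_ne_zero hxK hyK
  have hM : ∀ r k, ∀ f ∈ integralSeq O ω r k,
      obstruction R ω r k f ∈ (⊥ : Subalgebra R K).saturate (x * y) ∧
      ∃ m, (p : R) ^ m • obstruction R ω r k f ∈ latticeSum O := fun r k f hf =>
    ⟨obstruction_mem (O := O) (ω := ω) (O' := (⊥ : Subalgebra R K).saturate (x * y))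
      (Subalgebra.saturate_le_saturate_of_dvd _ (dvd_mul_right x y))
      (by rw [hθ]; exact algebraMap_div_pow_mem_saturate hxyK _ _) hf,
      exists_pow_smul_obstruction_mem (fun j => ⟨N, hωO j⟩) hf⟩
  have hkills : ∀ s : R, (∀ m : ℕ, 0 < m → Kills s (KoszulH1 ![(p : R) ^ m, x ^ m, y ^ m])) →
      ∀ r k, ∀ f ∈ integralSeq O ω r k, s • obstruction R ω r k f ∈ latticeSum O :=
    fun s hs r k f hf => by
      obtain ⟨h1, m, h2⟩ := hM r k f hf
      exact smul_mem_latticeSum hinj hxK hyK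
        (fun l hl E α β h => exists_mul_eq_of_kills_koszulH1 (hs l hl) h) h1 h2
  refine ⟨ω, hθ, exists_seq_pow_mul_twistedSum_mem (μ := (algebraMap R K (x * y))⁻¹)
    hp hpK (hkills _ fun m hm => (hkill m hm).1) hωO
    (fun r k f hf => mem_latticeSum_sup_span hxK hyK hR
      (hkills x (fun m hm => (hkill m hm).2.1) r k f hf)
      (hkills y (fun m hm => (hkill m hm).2.2) r k f hf)) ha hb⟩

theorem exists_pow_mul_eq_of_kills_koszulH1 (K L : Type*) [Field K] [Algebra R K]
    [IsFractionRing R K] [Field L] [IsAlgClosed L] [Algebra R L] [Algebra K L]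
    [IsScalarTower R K L] {p : ℕ} (hp : p.Prime) (hp0 : (p : R) ≠ 0) {x y : R} (hx0 : x ≠ 0)
    (hy0 : y ≠ 0) (hxy : 2 ≤ (Ideal.span {x, y}).height) {N : ℕ}
    (hkill : ∀ m : ℕ, 0 < m →
      Kills ((p : R) ^ N) (KoszulH1 ![(p : R) ^ m, x ^ m, y ^ m]) ∧
      Kills x (KoszulH1 ![(p : R) ^ m, x ^ m, y ^ m]) ∧
      Kills y (KoszulH1 ![(p : R) ^ m, x ^ m, y ^ m]))
    {z : R} (hz : (p : R) ^ N * z ∈ Ideal.span {x, y}) {a b : ℕ} (ha : 0 < a) (hb : 0 < b) :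
    ∃ ρ α β : L, IsIntegral R ρ ∧ IsIntegral R α ∧ IsIntegral R β ∧ ρ ^ b = p ∧
      ρ ^ a * algebraMap R L z = algebraMap R L x * α + algebraMap R L y * β := by
  have hinj : Function.Injective (algebraMap R K) := IsFractionRing.injective R K
  have hinjL : Function.Injective (algebraMap R L) := by
    rw [IsScalarTower.algebraMap_eq R K L]
    exact (algebraMap K L).injective.comp hinj
  obtain ⟨ω, hθ, n, f, hf0, hf⟩ := exists_seq_of_kills_koszulH1 K hp hp0 hx0 hy0 hxy hkill hz ha hb
  obtain ⟨ρ, hρ⟩ := IsAlgClosed.exists_pow_nat_eq (p : L) hb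
  have hρint : IsIntegral R ρ := IsIntegral.of_pow hb (by
    rw [hρ, ← map_natCast (algebraMap R L)]; exact isIntegral_algebraMap)
  set S : Fin 2 → Subalgebra R L := ![(integralClosure R L).saturate y,
    (integralClosure R L).saturate x] with hS
  have hbot : ∀ (s : R) (t : K), t ∈ (⊥ : Subalgebra R K).saturate s →
      algebraMap K L t ∈ (integralClosure R L).saturate s := by
    rintro s t ⟨m, hm⟩
    obtain ⟨c, hc⟩ := Algebra.mem_bot.1 hm
    refine ⟨m, ?_⟩
    have e : s ^ m • algebraMap K L t = algebraMap R L c := by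
      rw [IsScalarTower.algebraMap_apply R K L, hc, Algebra.smul_def, Algebra.smul_def, map_mul,
        ← IsScalarTower.algebraMap_apply]
    rw [e]
    exact Subalgebra.algebraMap_mem _ c
  obtain ⟨τ, hτ⟩ := exists_root_mem (S := S) (a := a)
    (by rw [Fin.forall_fin_two]; exact ⟨hbot y, hbot x⟩)
    (by
      rw [Fin.forall_fin_two]
      exact ⟨fun q c ζ h0 hc h => mem_saturate_integralClosure_of_sum_eq_zero h0 hc h,
        fun q c ζ h0 hc h => mem_saturate_integralClosure_of_sum_eq_zero h0 hc h⟩)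
    (pow_pos hp.pos n) hρ
    (by
      rw [Fin.forall_fin_two]
      exact ⟨Subalgebra.le_saturate _ _ hρint, Subalgebra.le_saturate _ _ hρint⟩)
    hf0 hf
  rw [Fin.forall_fin_two] at hτ
  obtain ⟨h0, h1⟩ := hτ
  set ζ₀ := ρ ^ a * (τ + algebraMap K L (ω 0)) with hζ₀
  set ζ₁ := ρ ^ a * (τ + algebraMap K L (ω 1)) with hζ₁
  have hxL : algebraMap R L x ≠ 0 := (map_ne_zero_iff _ hinjL).2 hx0
  have hyL : algebraMap R L y ≠ 0 := (map_ne_zero_iff _ hinjL).2 hy0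
  have hdiff : algebraMap R L x * (algebraMap R L y * ζ₀) -
      algebraMap R L y * (algebraMap R L x * ζ₁) = ρ ^ a * algebraMap R L z := by
    have e := congrArg (algebraMap K L) hθ
    rw [map_sub, map_div₀, map_pow, pow_one, ← IsScalarTower.algebraMap_apply,
      ← IsScalarTower.algebraMap_apply, map_mul, eq_div_iff (mul_ne_zero hxL hyL)] at e
    rw [hζ₀, hζ₁]
    linear_combination ρ ^ a * e
  have hmem : ∀ {s t : R} {ζ : L}, ζ ∈ (integralClosure R L).saturate s →
      algebraMap R L t * ζ ∈ (integralClosure R L).saturate s := fun h =>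
    Subalgebra.mul_mem _ (Subalgebra.algebraMap_mem _ _) h
  have hρz : IsIntegral R (ρ ^ a * algebraMap R L z) := (hρint.pow a).mul isIntegral_algebraMap
  have hq : ∀ {s : R}, algebraMap R L s ≠ 0 →
      ρ ^ a * algebraMap R L z / algebraMap R L s ∈ (integralClosure R L).saturate s := fun hs =>
    ⟨1, by rw [pow_one, Algebra.smul_def, mul_div_cancel₀ _ hs]; exact hρz⟩
  -- Each of the two products is integral over one localization by construction and over the other
  -- through `hdiff`.
  refine ⟨ρ, algebraMap R L y * ζ₀, -(algebraMap R L x * ζ₁), hρint, ?_, ?_, hρ, ?_⟩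
  · refine isIntegral_of_mem_saturate (K := K) hx0 hy0 hxy ?_ (hmem h0)
    have e : algebraMap R L y * ζ₀ = ρ ^ a * algebraMap R L z / algebraMap R L x +
        algebraMap R L y * ζ₁ := by
      rw [← hdiff]
      field_simp
      ring
    rw [e]
    exact Subalgebra.add_mem _ (hq hxL) (hmem h1)
  · refine (isIntegral_of_mem_saturate (K := K) hx0 hy0 hxy (hmem h1) ?_).neg
    have e : algebraMap R L x * ζ₁ = algebraMap R L x * ζ₀ -
        ρ ^ a * algebraMap R L z / algebraMap R L y := by
      rw [← hdiff]
      field_simp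
      ring
    rw [e]
    exact Subalgebra.sub_mem _ (hmem h0) (hq hyL)
  · rw [← hdiff]; ring

end Main

theorem IsParameterSet.ne_zero {R : Type u} [CommRing R] [IsDomain R] {ι : Type} {v : ι → R}
    (h : IsParameterSet v) (i : ι) : v i ≠ 0 := fun h0 => by
  have := h {i}
  rw [Finset.coe_singleton, Set.image_singleton, h0, Ideal.span_singleton_zero, Ideal.height_bot,
    Finset.card_singleton] at this
  exact absurd this (by norm_num)

theorem theorem2p7 {R : Type u} [CommRing R] [IsDomain R] [IsNoetherianRing R]
    [IsIntegrallyClosed R] [Finite (MaximalSpectrum R)]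
    (hht : ∀ m₁ m₂ : MaximalSpectrum R, m₁.asIdeal.height = m₂.asIdeal.height)
    (p : ℕ) (hp : p.Prime) (hpJ : (p : R) ∈ Ring.jacobson R) (hp0 : (p : R) ≠ 0)
    (x y : R) (hpar : IsParameterSet ![(p : R), x, y])
    (σ : R) (hσ : σ ^ (p - 1) = (p : R))
    (N : ℕ)
    (hkill : ∀ m : ℕ, 0 < m →
      Kills ((p : R) ^ N) (KoszulH1 ![(p : R) ^ m, x ^ m, y ^ m]) ∧
      Kills x (KoszulH1 ![(p : R) ^ m, x ^ m, y ^ m]) ∧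
      Kills y (KoszulH1 ![(p : R) ^ m, x ^ m, y ^ m]))
    (z : R) (hz : (p : R) ^ N * z ∈ Ideal.span {x, y}) :
    (∀ e : ℚ≥0, 0 < e →
      ∃ (S : Type u) (_ : CommRing S) (_ : IsDomain S) (_ : Algebra R S),
        Function.Injective (algebraMap R S) ∧ Module.Finite R S ∧
        ∃ t : S, IsRationalPower (p : S) e t ∧
          t * algebraMap R S z ∈ Ideal.span {algebraMap R S x, algebraMap R S y}) ∧
    z ∈ fullExtendedPlusClosure p (Ideal.span {x, y}) := by
  have hx0 : x ≠ 0 := hpar.ne_zero 1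
  have hy0 : y ≠ 0 := hpar.ne_zero 2
  have hxy : 2 ≤ (Ideal.span {x, y}).height := by
    have h := hpar {1, 2}
    rw [show ![(p : R), x, y] '' (({1, 2} : Finset (Fin 3)) : Set (Fin 3)) = {x, y} by
      simp [Set.image_pair]] at h
    rw [h]
    simp
  set L := AlgebraicClosure (FractionRing R) with hL
  have key := fun (a b : ℕ) (ha : 0 < a) (hb : 0 < b) => exists_pow_mul_eq_of_kills_koszulH1
    (FractionRing R) L hp hp0 hx0 hy0 hxy hkill hz ha hb
  have hinjL : Function.Injective (algebraMap R L) := by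
    rw [IsScalarTower.algebraMap_eq R (FractionRing R) L]
    exact (algebraMap (FractionRing R) L).injective.comp (IsFractionRing.injective R _)
  refine ⟨fun e he => ?_, (p : R), hp0, fun n hn => ?_⟩
  · obtain ⟨ρ, α, β, hρ, hα, hβ, hρp, h⟩ := key e.num e.den (NNRat.num_pos.2 he) e.den_pos
    let S := Algebra.adjoin R ({ρ, α, β} : Set L)
    have hmem : ∀ {t : L}, t ∈ ({ρ, α, β} : Set L) → t ∈ S := fun ht => Algebra.subset_adjoin ht
    refine ⟨S, inferInstance, inferInstance, inferInstance, fun r s h => hinjL (congrArg Subtype.val h),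
      ?_, ⟨ρ, hmem (by simp)⟩ ^ e.num, ⟨⟨ρ, hmem (by simp)⟩, Subtype.ext (by simpa using hρp), rfl⟩,
      ?_⟩
    · exact Module.Finite.iff_fg.2 (fg_adjoin_of_finite (by simp) (by
        rintro t (rfl | rfl | rfl) <;> assumption))
    · refine Ideal.mem_span_pair.2 ⟨⟨α, hmem (by simp)⟩, ⟨β, hmem (by simp)⟩, Subtype.ext ?_⟩
      simp only [Subalgebra.coe_add, Subalgebra.coe_mul, Subalgebra.coe_algebraMap,
        Subalgebra.coe_pow]
      rw [h]
      ring
  -- With c = p the product already lies in the extension of I, without the summand generated by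
  -- p^n.
  · obtain ⟨ρ, α, β, hρ, hα, hβ, hρp, h⟩ := key 1 n one_pos hn
    refine ⟨⟨ρ, hρ⟩, Subtype.ext (by simpa using hρp), Ideal.mem_sup_left ?_⟩
    rw [Ideal.map_span, Set.image_pair]
    refine Ideal.mem_span_pair.2 ⟨⟨α, hα⟩, ⟨β, hβ⟩, Subtype.ext ?_⟩
    simp only [Subalgebra.coe_add, Subalgebra.coe_mul, Subalgebra.coe_algebraMap]
    rw [pow_one] at h
    rw [h]
    ring
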